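/- **Setting.** Let $\Sigma\supseteq\mathbb R_{\ge 0}$ be a timed sort and $\mathcal T=(\mathcal S,\to)$ a timed transition system of sort $\Sigma$: a labelled transition system with ${\to}\subseteq\mathcal S\times\Sigma\times\mathcal S$ that is time-reflexive ($s\xrightarrow{0}s$), time-deterministic ($s\xrightarrow{\delta}s'$ and $s\xrightarrow{\delta}s''$ imply $s'=s''$), time-additive ($s\xrightarrow{\delta}s'\xrightarrow{\delta'}s''$ implies $s\xrightarrow{\delta+\delta'}s''$) and time-continuous (if $s\xrightarrow{\delta+\delta'}s'$ then $s\xrightarrow{\delta}s''\xrightarrow{\delta'}s'$ for some $s''$), for all $\delta,\delta'\in\mathbb R_{\ge0}$. Write $s\xrightarrow{K}s'$ if $s\xrightarrow{a}s'$ for some $a\in K\subseteq\Sigma$; write $\mathrm{succ}(s,\delta)=s'$ if $s\xrightarrow{\delta}s'$, $\mathrm{del}(s)=\{\delta\in\mathbb R_{\ge0}: \mathrm{succ}(s,\delta)\text{ is defined}\}$ and $\mathrm{succ}_<(s,\delta)=\{\mathrm{succ}(s,\delta'):\delta'\in\mathrm{del}(s),\ \delta'<\delta\}$. Let $\mathrm{Var}$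 be a countably infinite set of variables and $\mathcal V:\mathrm{Var}\to 2^{\mathcal S}$ a valuation. **Formulas.** Formulas are built from variables by $\neg,\wedge,\vee,[K],\langle K\rangle$, release $\forall_{\Phi_1}(\Phi_2)$, until $\exists_{\Phi_1}(\Phi_2)$, $\mu Z.\Phi$ and $\nu Z.\Phi$. A variable is positive in $\Phi$ if each of its free occurrences is under an even number of negations; a formula is well-formed if $Z$ is positive in $\Phi$ for each subformula $\mu Z.\Phi$ or $\nu Z.\Phi$; it is in positive normal form if negations are applied to variables only. The semantics $[\![\Phi]\!]_{\mathcal V}\subseteq\mathcal S$ is the standard one of the modal mu-calculus; $s\in[\![\forall_{\Phi_1}(\Phi_2)]\!]_{\mathcal V}$ iff for all $\delta\in\mathrm{del}(s)$, $\mathrm{succ}_<(s,\delta)\cap[\![\Phi_1]\!]_{\mathcal V}=\emptyset$ implies $\mathrm{succ}(s,\delta)\in[\![\Phi_2]\!]_{\mathcal V}$; and $s\in[\![\exists_{\Phi_1}(\Phi_2)]\!]_{\mathcal V}$ iff for some $\delta\in\mathrm{del}(s)$, $\mathrm{succ}_<(s,\delta)\subseteq[\![\Phi_1]\!]_{\mathcal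 V}$ and $\mathrm{succ}(s,\delta)\in[\![\Phi_2]\!]_{\mathcal V}$. **Sequents.** A definition list $\Delta=(U_1=\Phi_1)\cdots(U_n=\Phi_n)$ has pairwise distinct variables $U_i$ (its constants, forming $\mathrm{dom}(\Delta)$) and well-formed formulas $\Phi_i$, where no $U_i$ is bound in any $\Phi_j$ and $U_j$ is not free in $\Phi_i$ for $i\le j$. A sequent $S\vdash_\Delta\Phi$ consists of $S\subseteq\mathcal S$, a definition list $\Delta$ and a well-formed formula $\Phi$ in positive normal form in which each $U\in\mathrm{dom}(\Delta)$ is positive and not bound. It is valid if $S\subseteq[\![\Phi]\!]_{\mathcal V[\Delta]}$, where $\mathcal V[\Delta]$ extends $\mathcal V$ by interpreting the constants successively from left to right. In particular, for empty $\Delta$ it is valid iff $S\subseteq[\![\Phi]\!]_{\mathcal V}$. **Rules** (conclusion, then premises): - $\wedge$: $S\vdash_\Delta\Phi_1\wedge\Phi_2$; $\;S\vdash_\Delta\Phi_1$ and $S\vdash_\Delta\Phi_2$. - $\vee$: $S\vdash_\Delta\Phi_1\vee\Phi_2$; $\;S_1\vdash_\Delta\Phi_1$ and $S_2\vdash_\Delta\Phi_2$,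 with $S=S_1\cup S_2$. - $[K]$: $S\vdash_\Delta[K]\Phi$; $\;\{s':\exists s\in S,\ s\xrightarrow{K}s'\}\vdash_\Delta\Phi$. - $(\langle K\rangle,f)$: $S\vdash_\Delta\langle K\rangle\Phi$; $\;f(S)\vdash_\Delta\Phi$, where $f:S\to\mathcal S$ and $s\xrightarrow{K}f(s)$ for all $s\in S$. - $\sigma Z$ ($\sigma\in\{\mu,\nu\}$): $S\vdash_\Delta\sigma Z.\Phi$; $\;S\vdash_{\Delta\cdot(U=\sigma Z.\Phi)}U$, with $U$ fresh, i.e. occurring in the tableau only strictly below the node at which the rule is applied. - Un: $S\vdash_\Delta U$ with $\Delta(U)=\sigma Z.\Phi$; $\;S\vdash_\Delta\Phi[Z:=U]$. - Thin: $S\vdash_\Delta\Phi$; $\;S'\vdash_\Delta\Phi$ with $S\subseteq S'$. - $(\exists,f)$: $S\vdash_\Delta\exists_{\Phi_1}(\Phi_2)$; $\;\bigcup_{s\in S}\mathrm{succ}_<(s,f(s))\vdash_\Delta\Phi_1$ and $\{\mathrm{succ}(s,f(s)):s\in S\}\vdash_\Delta\Phi_2$, where $f:S\to\mathbb R_{\ge0}$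 and $f(s)\in\mathrm{del}(s)$ for all $s\in S$. - $(\forall,g)$: $S\vdash_\Delta\forall_{\Phi_1}(\Phi_2)$; $\;\{\mathrm{succ}(s,g(s,\delta)):s\in S,\delta\in\mathrm{del}(s),g(s,\delta)<\delta\}\vdash_\Delta\Phi_1$ and $\{\mathrm{succ}(s,g(s,\delta)):s\in S,\delta\in\mathrm{del}(s),g(s,\delta)=\delta\}\vdash_\Delta\Phi_2$, where $g(s,\delta)\le\delta$ for all $s\in S$, $\delta\in\mathrm{del}(s)$. **Tableaux.** A partial timed tableau is a finite non-empty ordered tree whose nodes $n$ are labelled by sequents $S_n\vdash_{\Delta_n}\Phi_n$ and whose internal nodes are labelled by rule applications such that the sequents of each internal node and of its children, from left to right, are an instance of the rule. Nodes at which Un is applied are companion nodes. A leaf $n$ with $\Phi_n=U\in\mathrm{dom}(\Delta_n)$ and $\Delta_n(U)=\sigma Z.\Phi$ is a $\sigma$-leaf if some companion node $m$ that is a strict ancestor of $n$ satisfies $\Phi_m=U$ and $S_n\subseteq S_m$; $n$ is then a companion leaf of the deepest such $m$. A timed tableau is a partial timed tableau such that the definition list of the root is empty and each leaf $n$ is a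 free leaf ($\Phi_n=Z$ or $\Phi_n=\neg Z$ with $Z\notin\mathrm{dom}(\Delta_n)$), a diamond leaf ($\Phi_n=\langle K\rangle\Phi$ and some $s\in S_n$ has no $K$-transition), or a $\sigma$-leaf. **Dependency orderings.** For a child $n'$ of $n$, $s\in S_n$ and $s'\in S_{n'}$, let $s'<_{n',n}s$ iff: the rule at $n$ is $[K]$ and $s\xrightarrow{K}s'$; or it is $(\langle K\rangle,f)$ and $s'=f(s)$; or it is $(\exists,f)$ and either $n'$ is the first child and $s'\in\mathrm{succ}_<(s,f(s))$, or $n'$ is the second child and $s'=\mathrm{succ}(s,f(s))$; or it is $(\forall,g)$ and $s'=\mathrm{succ}(s,g(s,\delta))$ for some $\delta\in\mathrm{del}(s)$ with $g(s,\delta)<\delta$ if $n'$ is the first child, respectively $g(s,\delta)=\delta$ if $n'$ is the second child; or it is another rule and $s'=s$. Let $s'\lessdot_{n',n}s$ iff $s$ and $s'$ are connected by a (possibly empty) chain of these relations along the path from $n$ down to $n'$, where $s\in S_n$, $s'\in S_{n'}$. Let the relations $<:_{n',n}$ and $<:_m$ ($m$ a companion node) be the least relations such that - $s'<:_{n',n}s$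 if $s'\lessdot_{n',n}s$; - $s'<:_{n',n}s$ if there are a companion node $m\ne n,n'$ and $t,t'\in S_m$ with $s'<:_{n',m}t'$, $t'<:_m^+t$ and $t\lessdot_{m,n}s$, where ${}^+$ is transitive closure; - $s'<:_m s$ if $s,s'\in S_m$ and $s'\in S_{m'}$, $s'<:_{m',m}s$ for some companion leaf $m'$ of $m$. **Success.** A leaf $n$ is successful if $\Phi_n=Z\notin\mathrm{dom}(\Delta_n)$ and $S_n\subseteq\mathcal V(Z)$; or $\Phi_n=\neg Z$, $Z\notin\mathrm{dom}(\Delta_n)$ and $S_n\cap\mathcal V(Z)=\emptyset$; or $n$ is a $\nu$-leaf; or $n$ is a $\mu$-leaf and $<:_m$ is well-founded (has no infinite descending chain) for the companion node $m$ of which $n$ is a companion leaf. A tableau is successful if all its leaves are. **Theorem (Soundness of the timed mu-calculus proof system).** For every timed transition system $\mathcal T$ of timed sort $\Sigma$ and every valuation $\mathcal V$: if there is a successful timed tableau over $\mathcal T$ and $\mathcal V$ whose root is labelled by a sequent $\mathbf s=S\vdash_\Delta\Phi$ with empty definition list $\Delta$, then $\mathbf s$ is valid, i.e. $S\subseteq[\![\Phi]\!]_{\mathcal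 V}$. -/

import Mathlib

open scoped NNReal

namespace TimedMu

universe u v w x

/-! ## Timed transition systems -/

/-- A timed transition system.  A timed sort is a disjoint union of a set `Act` of actions and the
set `ℝ≥0` of time delays. -/
structure TTS (Act : Type u) (St : Type v) where
  Tr : St → Act ⊕ ℝ≥0 → St → Prop
  time_reflexive : ∀ s, Tr s (Sum.inr 0) s
  time_deterministic : ∀ s s₁ s₂ (d : ℝ≥0), Tr s (Sum.inr d) s₁ → Tr s (Sum.inr d) s₂ → s₁ = s₂
  time_additive : ∀ s s₁ s₂ (d e : ℝ≥0),
    Tr s (Sum.inr d) s₁ → Tr s₁ (Sum.inr e) s₂ → Tr s (Sum.inr (d + e)) s₂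
  time_continuous : ∀ s s₁ (d : ℝ≥0), Tr s (Sum.inr d) s₁ →
    ∀ e e' : ℝ≥0, d = e + e' → ∃ s₂, Tr s (Sum.inr e) s₂ ∧ Tr s₂ (Sum.inr e') s₁

namespace TTS

variable {Act : Type u} {St : Type v}

/-- `s →ᴷ s'`: a transition labelled by some element of `K`. -/
def StepIn (T : TTS Act St) (K : Set (Act ⊕ ℝ≥0)) (s s' : St) : Prop :=
  ∃ a ∈ K, T.Tr s a s'

/-- `T.Delay s d s'` says that `succ(s, d)` is defined and equal to `s'`. -/
def Delay (T : TTS Act St) (s : St) (d : ℝ≥0) (s' : St) : Prop :=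
  T.Tr s (Sum.inr d) s'

/-- The possible delays from `s`. -/
def delays (T : TTS Act St) (s : St) : Set ℝ≥0 :=
  {d | ∃ s', T.Delay s d s'}

/-- The states reachable from `s` by delays strictly smaller than `d`. -/
def succLT (T : TTS Act St) (s : St) (d : ℝ≥0) : Set St :=
  {s' | ∃ e, e < d ∧ T.Delay s e s'}

end TTS

/-! ## Formulas -/

/-- The two kinds of fixpoints. -/
inductive FixKind where
  | mu
  | nu

/-- Formulas of the timed modal mu-calculus, extended with the dual operators. -/
inductive Form (Var : Type w) (Act : Type u) where
  | var (Z : Var)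
  | neg (Φ : Form Var Act)
  | and (Φ Ψ : Form Var Act)
  | or (Φ Ψ : Form Var Act)
  /-- `[K] Φ` -/
  | box (K : Set (Act ⊕ ℝ≥0)) (Φ : Form Var Act)
  /-- `⟨K⟩ Φ` -/
  | dia (K : Set (Act ⊕ ℝ≥0)) (Φ : Form Var Act)
  /-- release: `∀_Φ (Ψ)` -/
  | rel (Φ Ψ : Form Var Act)
  /-- until: `∃_Φ (Ψ)` -/
  | til (Φ Ψ : Form Var Act)
  /-- `σ Z. Φ` -/
  | fix (k : FixKind) (Z : Var) (Φ : Form Var Act)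

/-- Valuations of the propositional variables. -/
abbrev Valuation (Var : Type w) (St : Type v) := Var → Set St

namespace Form

variable {Var : Type w} {Act : Type u} {St : Type v}

/-- The variables with a free occurrence. -/
def freeVars : Form Var Act → Set Var
  | var Z => {Z}
  | neg Φ => Φ.freeVars
  | and Φ Ψ => Φ.freeVars ∪ Ψ.freeVars
  | or Φ Ψ => Φ.freeVars ∪ Ψ.freeVars
  | box _ Φ => Φ.freeVars
  | dia _ Φ => Φ.freeVars
  | rel Φ Ψ => Φ.freeVars ∪ Ψ.freeVars
  | til Φ Ψ => Φ.freeVars ∪ Ψ.freeVars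
  | fix _ Z Φ => Φ.freeVars \ {Z}

/-- The variables that are bound somewhere in the formula. -/
def boundVars : Form Var Act → Set Var
  | var _ => ∅
  | neg Φ => Φ.boundVars
  | and Φ Ψ => Φ.boundVars ∪ Ψ.boundVars
  | or Φ Ψ => Φ.boundVars ∪ Ψ.boundVars
  | box _ Φ => Φ.boundVars
  | dia _ Φ => Φ.boundVars
  | rel Φ Ψ => Φ.boundVars ∪ Ψ.boundVars
  | til Φ Ψ => Φ.boundVars ∪ Ψ.boundVars
  | fix _ Z Φ => insert Z Φ.boundVars

/-- `Parity Z true Φ`: every free occurrence of `Z` in `Φ` is under an even number of negations;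
`Parity Z false Φ`: every free occurrence of `Z` in `Φ` is under an odd number of negations. -/
def Parity (Z : Var) : Bool → Form Var Act → Prop
  | b, var W => W = Z → b = true
  | b, neg Φ => Parity Z (!b) Φ
  | b, and Φ Ψ => Parity Z b Φ ∧ Parity Z b Ψ
  | b, or Φ Ψ => Parity Z b Φ ∧ Parity Z b Ψ
  | b, box _ Φ => Parity Z b Φ
  | b, dia _ Φ => Parity Z b Φ
  | b, rel Φ Ψ => Parity Z b Φ ∧ Parity Z b Ψ
  | b, til Φ Ψ => Parity Z b Φ ∧ Parity Z b Ψ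
  | b, fix _ W Φ => W = Z ∨ Parity Z b Φ

/-- `Z` is positive in `Φ`. -/
def PositiveIn (Z : Var) (Φ : Form Var Act) : Prop := Parity Z true Φ

/-- Well-formedness: the bound variable of every fixpoint subformula is positive in its body. -/
def WellFormed : Form Var Act → Prop
  | var _ => True
  | neg Φ => Φ.WellFormed
  | and Φ Ψ => Φ.WellFormed ∧ Ψ.WellFormed
  | or Φ Ψ => Φ.WellFormed ∧ Ψ.WellFormed
  | box _ Φ => Φ.WellFormed
  | dia _ Φ => Φ.WellFormed
  | rel Φ Ψ => Φ.WellFormed ∧ Ψ.WellFormed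
  | til Φ Ψ => Φ.WellFormed ∧ Ψ.WellFormed
  | fix _ Z Φ => PositiveIn Z Φ ∧ Φ.WellFormed

/-- Positive normal form: negations apply to variables only. -/
def PNF : Form Var Act → Prop
  | var _ => True
  | neg Φ => ∃ Z, Φ = var Z
  | and Φ Ψ => Φ.PNF ∧ Ψ.PNF
  | or Φ Ψ => Φ.PNF ∧ Ψ.PNF
  | box _ Φ => Φ.PNF
  | dia _ Φ => Φ.PNF
  | rel Φ Ψ => Φ.PNF ∧ Ψ.PNF
  | til Φ Ψ => Φ.PNF ∧ Ψ.PNF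
  | fix _ _ Φ => Φ.PNF

/-- Replacement of the free occurrences of `Z` by the variable `U`.  It is only used where `U` is
not bound in the formula, so that no capture can occur and no renaming is needed. -/
def subst [DecidableEq Var] (Z U : Var) : Form Var Act → Form Var Act
  | var W => if W = Z then var U else var W
  | neg Φ => neg (Φ.subst Z U)
  | and Φ Ψ => and (Φ.subst Z U) (Ψ.subst Z U)
  | or Φ Ψ => or (Φ.subst Z U) (Ψ.subst Z U)
  | box K Φ => box K (Φ.subst Z U)
  | dia K Φ => dia K (Φ.subst Z U)
  | rel Φ Ψ => rel (Φ.subst Z U) (Ψ.subst Z U)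
  | til Φ Ψ => til (Φ.subst Z U) (Ψ.subst Z U)
  | fix k W Φ => if W = Z then fix k W Φ else fix k W (Φ.subst Z U)

/-- The set of states that satisfy a formula. -/
def sem [DecidableEq Var] (T : TTS Act St) : Form Var Act → Valuation Var St → Set St
  | var Z, V => V Z
  | neg Φ, V => (Φ.sem T V)ᶜ
  | and Φ Ψ, V => Φ.sem T V ∩ Ψ.sem T V
  | or Φ Ψ, V => Φ.sem T V ∪ Ψ.sem T V
  | box K Φ, V => {s | ∀ s', T.StepIn K s s' → s' ∈ Φ.sem T V}
  | dia K Φ, V => {s | ∃ s' ∈ Φ.sem T V, T.StepIn K s s'}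
  | rel Φ Ψ, V => {s | ∀ d s', T.Delay s d s' →
      T.succLT s d ∩ Φ.sem T V = ∅ → s' ∈ Ψ.sem T V}
  | til Φ Ψ, V => {s | ∃ d s', T.Delay s d s' ∧
      T.succLT s d ⊆ Φ.sem T V ∧ s' ∈ Ψ.sem T V}
  | fix FixKind.nu Z Φ, V => ⋃₀ {S | S ⊆ Φ.sem T (Function.update V Z S)}
  | fix FixKind.mu Z Φ, V => ⋂₀ {S | Φ.sem T (Function.update V Z S) ⊆ S}

end Form

/-! ## Definition lists and sequents -/

/-- A list `(U₁ = Φ₁) ⋯ (Uₙ = Φₙ)` of equations. -/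
abbrev DefList (Var : Type w) (Act : Type u) := List (Var × Form Var Act)

namespace DefList

variable {Var : Type w} {Act : Type u} {St : Type v}

/-- The definitional constants. -/
def dom (Δ : DefList Var Act) : Set Var := {U | ∃ Φ, (U, Φ) ∈ Δ}

/-- The conditions that make a list of equations a definition list. -/
structure IsDefList (Δ : DefList Var Act) : Prop where
  wellFormed : ∀ p ∈ Δ, p.2.WellFormed
  nodup : (Δ.map Prod.fst).Nodup
  not_bound : ∀ p ∈ Δ, ∀ q ∈ Δ, p.1 ∉ q.2.boundVars
  not_free : ∀ i j : Fin Δ.length, i ≤ j → (Δ.get j).1 ∉ (Δ.get i).2.freeVars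

/-- The extension `V[Δ]` of a valuation by a definition list. -/
def extend [DecidableEq Var] (T : TTS Act St) : DefList Var Act → Valuation Var St →
    Valuation Var St
  | [], V => V
  | (U, Φ) :: Δ, V => extend T Δ (Function.update V U (Φ.sem T V))

end DefList

/-- The data of a sequent `S ⊢_Δ Φ`. -/
@[ext]
structure Sequent (Var : Type w) (Act : Type u) (St : Type v) where
  st : Set St
  dl : DefList Var Act
  fm : Form Var Act

namespace Sequent

variable {Var : Type w} {Act : Type u} {St : Type v}

/-- The conditions that make the data a sequent. -/
structure IsSequent (s : Sequent Var Act St) : Prop where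
  isDefList : DefList.IsDefList s.dl
  wellFormed : s.fm.WellFormed
  pnf : s.fm.PNF
  positive : ∀ U ∈ DefList.dom s.dl, Form.PositiveIn U s.fm
  not_bound : ∀ U ∈ DefList.dom s.dl, U ∉ s.fm.boundVars

/-- The variables that occur, in whatever way, in a sequent. -/
def vars (s : Sequent Var Act St) : Set Var :=
  s.fm.freeVars ∪ s.fm.boundVars ∪ DefList.dom s.dl ∪
    {U | ∃ p ∈ s.dl, U ∈ p.2.freeVars ∪ p.2.boundVars}

/-- The semantics of a sequent. -/
def sem [DecidableEq Var] (T : TTS Act St) (V : Valuation Var St) (s : Sequent Var Act St) :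
    Set St :=
  s.fm.sem T (DefList.extend T s.dl V)

/-- A sequent is valid if all of its states satisfy its formula. -/
def Valid [DecidableEq Var] (T : TTS Act St) (V : Valuation Var St) (s : Sequent Var Act St) :
    Prop :=
  s.st ⊆ s.sem T V

end Sequent

/-! ## Proof rules -/

/-- Rule applications.  Witness functions are defined on all states for convenience; only their
values on the state set of the conclusion (and, for `all`, on the possible delays) matter. -/
inductive RuleAppl (Act : Type u) (St : Type v) where
  | and
  | or
  | box (K : Set (Act ⊕ ℝ≥0))
  | dia (K : Set (Act ⊕ ℝ≥0)) (f : St → St)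
  | fix (k : FixKind)
  | un
  | thin
  /-- the `∃` (until) rule with its witness delay function -/
  | ex (f : St → ℝ≥0)
  /-- the `∀` (release) rule with its witness delay function -/
  | all (g : St → ℝ≥0 → ℝ≥0)

/-- `a.Applies T fresh s l`: the conclusion `s` and the premises `l` have the form, and satisfy the
side condition, of the rule application `a`; `fresh` says which variables are fresh. -/
def RuleAppl.Applies {Var : Type w} {Act : Type u} {St : Type v} [DecidableEq Var]
    (T : TTS Act St) (fresh : Var → Prop) (a : RuleAppl Act St)
    (s : Sequent Var Act St) (l : List (Sequent Var Act St)) : Prop :=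
  match a with
  | .and => ∃ Φ Ψ, s.fm = .and Φ Ψ ∧ l = [⟨s.st, s.dl, Φ⟩, ⟨s.st, s.dl, Ψ⟩]
  | .or => ∃ Φ Ψ S₁ S₂, s.fm = .or Φ Ψ ∧ s.st = S₁ ∪ S₂ ∧
      l = [⟨S₁, s.dl, Φ⟩, ⟨S₂, s.dl, Ψ⟩]
  | .box K => ∃ Φ, s.fm = .box K Φ ∧ l = [⟨{y | ∃ z ∈ s.st, T.StepIn K z y}, s.dl, Φ⟩]
  | .dia K f => ∃ Φ, s.fm = .dia K Φ ∧ (∀ z ∈ s.st, T.StepIn K z (f z)) ∧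
      l = [⟨f '' s.st, s.dl, Φ⟩]
  | .fix k => ∃ Z Φ U, s.fm = .fix k Z Φ ∧ fresh U ∧
      l = [⟨s.st, s.dl ++ [(U, .fix k Z Φ)], .var U⟩]
  | .un => ∃ U k Z Φ, s.fm = .var U ∧ (U, .fix k Z Φ) ∈ s.dl ∧
      l = [⟨s.st, s.dl, Φ.subst Z U⟩]
  | .thin => ∃ S, s.st ⊆ S ∧ l = [⟨S, s.dl, s.fm⟩]
  | .ex f => ∃ Φ Ψ, s.fm = .til Φ Ψ ∧ (∀ z ∈ s.st, f z ∈ T.delays z) ∧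
      l = [⟨⋃ z ∈ s.st, T.succLT z (f z), s.dl, Φ⟩,
        ⟨{y | ∃ z ∈ s.st, T.Delay z (f z) y}, s.dl, Ψ⟩]
  | .all g => ∃ Φ Ψ, s.fm = .rel Φ Ψ ∧ (∀ z ∈ s.st, ∀ d ∈ T.delays z, g z d ≤ d) ∧
      l = [⟨{y | ∃ z ∈ s.st, ∃ d ∈ T.delays z, g z d < d ∧ T.Delay z (g z d) y}, s.dl, Φ⟩,
        ⟨{y | ∃ z ∈ s.st, ∃ d ∈ T.delays z, g z d = d ∧ T.Delay z (g z d) y}, s.dl, Ψ⟩]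

/-! ## Tableaux -/

/-- Ordered trees with node set `N` (finite trees if `N` is finite): a root, a partial parent
function, and for every node the list of its children from left to right. -/
structure OrderedTree (N : Type x) where
  root : N
  parent : N → Option N
  parent_eq_none : ∀ n, parent n = none ↔ n = root
  root_anc : ∀ n, Relation.ReflTransGen (fun m n' => parent n' = some m) root n
  cs : N → List N
  cs_nodup : ∀ n, (cs n).Nodup
  mem_cs : ∀ n n', n' ∈ cs n ↔ parent n' = some n

namespace OrderedTree

variable {N : Type x}

/-- `m` is a (not necessarily strict) ancestor of `n`. -/
def Anc (t : OrderedTree N) (m n : N) : Prop :=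
  Relation.ReflTransGen (fun a b => t.parent b = some a) m n

/-- `m` is a strict ancestor of `n`. -/
def StrictAnc (t : OrderedTree N) (m n : N) : Prop :=
  t.Anc m n ∧ m ≠ n

def IsLeaf (t : OrderedTree N) (n : N) : Prop := t.cs n = []

end OrderedTree

/-- Partial timed tableaux.  A variable is fresh at a node to which a fixpoint rule is applied if
it occurs in no sequent of the tableau except at strict descendants of that node. -/
structure PartialTableau {Var : Type w} {Act : Type u} {St : Type v} [DecidableEq Var]
    (T : TTS Act St) (V : Valuation Var St) (N : Type x) where
  tree : OrderedTree N
  rule : N → Option (RuleAppl Act St)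
  rule_eq_none : ∀ n, rule n = none ↔ tree.IsLeaf n
  lab : N → Sequent Var Act St
  isSequent : ∀ n, (lab n).IsSequent
  applies : ∀ n a, rule n = some a →
    a.Applies T (fun U => ∀ m, ¬ tree.StrictAnc n m → U ∉ (lab m).vars)
      (lab n) ((tree.cs n).map lab)

namespace PartialTableau

variable {Var : Type w} {Act : Type u} {St : Type v} {N : Type x} [DecidableEq Var]
  {T : TTS Act St} {V : Valuation Var St}

/-- Companion nodes are the nodes at which a definitional constant is unfolded. -/
def IsCompanionNode (𝕋 : PartialTableau T V N) (m : N) : Prop :=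
  𝕋.rule m = some .un

/-- `m` is a companion node strictly above `n` with the same definitional constant as `n`, and its
state set includes that of `n`. -/
def Candidate (𝕋 : PartialTableau T V N) (m n : N) : Prop :=
  𝕋.IsCompanionNode m ∧ 𝕋.tree.StrictAnc m n ∧ (𝕋.lab m).fm = (𝕋.lab n).fm ∧
    (𝕋.lab n).st ⊆ (𝕋.lab m).st

/-- `n` is a companion leaf of `m`: `m` is the deepest candidate for the leaf `n`. -/
def IsCompanionLeaf (𝕋 : PartialTableau T V N) (m n : N) : Prop :=
  𝕋.tree.IsLeaf n ∧ 𝕋.Candidate m n ∧ ∀ m', 𝕋.Candidate m' n → 𝕋.tree.Anc m' m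

/-- Free leaves. -/
def IsFreeLeaf (𝕋 : PartialTableau T V N) (n : N) : Prop :=
  𝕋.tree.IsLeaf n ∧ ∃ Z, Z ∉ DefList.dom (𝕋.lab n).dl ∧
    ((𝕋.lab n).fm = .var Z ∨ (𝕋.lab n).fm = .neg (.var Z))

/-- Diamond leaves. -/
def IsDiamondLeaf (𝕋 : PartialTableau T V N) (n : N) : Prop :=
  𝕋.tree.IsLeaf n ∧ ∃ K Φ, (𝕋.lab n).fm = .dia K Φ ∧
    ∃ s ∈ (𝕋.lab n).st, ∀ s', ¬ T.StepIn K s s'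

/-- `μ`-leaves and `ν`-leaves. -/
def IsFixLeaf (𝕋 : PartialTableau T V N) (k : FixKind) (n : N) : Prop :=
  𝕋.tree.IsLeaf n ∧ ∃ U, (𝕋.lab n).fm = .var U ∧
    (∃ Z Φ, (U, .fix k Z Φ) ∈ (𝕋.lab n).dl) ∧ ∃ m, 𝕋.Candidate m n

/-- Complete tableaux: the definition list of the root is empty and all leaves are terminal. -/
def IsTableau (𝕋 : PartialTableau T V N) : Prop :=
  (𝕋.lab 𝕋.tree.root).dl = [] ∧
    ∀ n, 𝕋.tree.IsLeaf n → 𝕋.IsFreeLeaf n ∨ 𝕋.IsDiamondLeaf n ∨ ∃ k, 𝕋.IsFixLeaf k n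

/-- The local dependency ordering: `LocalDep n' n s' s` is `s' <_{n',n} s`. -/
def LocalDep (𝕋 : PartialTableau T V N) (n' n : N) (s' s : St) : Prop :=
  𝕋.tree.parent n' = some n ∧ s' ∈ (𝕋.lab n').st ∧ s ∈ (𝕋.lab n).st ∧
    match 𝕋.rule n with
    | none => False
    | some (.box K) => T.StepIn K s s'
    | some (.dia _ f) => s' = f s
    | some (.ex f) => ∃ n₁ n₂, 𝕋.tree.cs n = [n₁, n₂] ∧
        ((n' = n₁ ∧ s' ∈ T.succLT s (f s)) ∨ (n' = n₂ ∧ T.Delay s (f s) s'))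
    | some (.all g) => ∃ n₁ n₂, 𝕋.tree.cs n = [n₁, n₂] ∧
        ((n' = n₁ ∧ ∃ d ∈ T.delays s, g s d < d ∧ T.Delay s (g s d) s') ∨
          (n' = n₂ ∧ ∃ d ∈ T.delays s, g s d = d ∧ T.Delay s (g s d) s'))
    | some .and => s' = s
    | some .or => s' = s
    | some (.fix _) => s' = s
    | some .un => s' = s
    | some .thin => s' = s

/-- The dependency ordering: `Dep n' n s' s` is `s' ⋖_{n',n} s`. -/
inductive Dep (𝕋 : PartialTableau T V N) : N → N → St → St → Prop where
  | refl {n : N} {s : St} : s ∈ (𝕋.lab n).st → Dep 𝕋 n n s s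
  | step {n' m n : N} {s' s'' s : St} :
      Dep 𝕋 n' m s' s'' → 𝕋.LocalDep m n s'' s → Dep 𝕋 n' n s' s

mutual

/-- The extended dependency ordering: `ExtDep n' n s' s` is `s' <:_{n',n} s`. -/
inductive ExtDep (𝕋 : PartialTableau T V N) : N → N → St → St → Prop where
  | base {n' n : N} {s' s : St} : 𝕋.Dep n' n s' s → ExtDep 𝕋 n' n s' s
  | step {n' m n : N} {s' t' t s : St} : 𝕋.IsCompanionNode m → m ≠ n → m ≠ n' →
      ExtDep 𝕋 n' m s' t' → CompDepPlus 𝕋 m t' t → 𝕋.Dep m n t s → ExtDep 𝕋 n' n s' s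

/-- The companion-node ordering: `CompDep m s' s` is `s' <:_m s`. -/
inductive CompDep (𝕋 : PartialTableau T V N) : N → St → St → Prop where
  | intro {m m' : N} {s' s : St} : 𝕋.IsCompanionNode m → s ∈ (𝕋.lab m).st → s' ∈ (𝕋.lab m).st →
      𝕋.IsCompanionLeaf m m' → s' ∈ (𝕋.lab m').st → ExtDep 𝕋 m' m s' s → CompDep 𝕋 m s' s

/-- The transitive closure of the companion-node ordering `CompDep m`. -/
inductive CompDepPlus (𝕋 : PartialTableau T V N) : N → St → St → Prop where
  | single {m : N} {s' s : St} : CompDep 𝕋 m s' s → CompDepPlus 𝕋 m s' s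
  | tail {m : N} {s'' s' s : St} :
      CompDepPlus 𝕋 m s'' s' → CompDep 𝕋 m s' s → CompDepPlus 𝕋 m s'' s

end

/-- Successful leaves. -/
def IsSuccessfulLeaf (𝕋 : PartialTableau T V N) (n : N) : Prop :=
  (∃ Z, Z ∉ DefList.dom (𝕋.lab n).dl ∧ (𝕋.lab n).fm = .var Z ∧ (𝕋.lab n).st ⊆ V Z) ∨
  (∃ Z, Z ∉ DefList.dom (𝕋.lab n).dl ∧ (𝕋.lab n).fm = .neg (.var Z) ∧
    (𝕋.lab n).st ∩ V Z = ∅) ∨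
  𝕋.IsFixLeaf .nu n ∨
  (𝕋.IsFixLeaf .mu n ∧ ∀ m, 𝕋.IsCompanionLeaf m n → WellFounded (𝕋.CompDep m))

/-- Successful tableaux. -/
def IsSuccessful (𝕋 : PartialTableau T V N) : Prop :=
  𝕋.IsTableau ∧ ∀ n, 𝕋.tree.IsLeaf n → 𝕋.IsSuccessfulLeaf n

/-- `𝕋` is a tableau for the sequent `s`. -/
def IsFor (𝕋 : PartialTableau T V N) (s : Sequent Var Act St) : Prop :=
  𝕋.lab 𝕋.tree.root = s

end PartialTableau

end TimedMu

namespace TimedMu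

-- The ancestor order of a tree.

namespace OrderedTree

variable {N : Type*}

-- Validity is proved directly for the given tableau, by induction on the tree with descendants
-- first. What must be generalised is the valuation: below a fixpoint node the constants are
-- interpreted by a varying `ρ`, and the claim at node `n` and state `s` (`mem_sem_of_supports`) is
-- that `s` satisfies the formula of `n` under every `ρ` with `Supports 𝕋 ρ n s`. This condition is
-- local to the configurations reachable from `(n, s)` by dependency steps and by jumps from
-- companion leaves back to companion nodes inside the subtree of `n`. It asks that free variables
-- keep their value, that each constant either satisfies its defining equation or already contains
-- every reachable state at which it is unfolded, and that reachable leaves whose companion lies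
-- strictly above `n` hold. At the root all of this is trivial.
--
-- The fixpoint rule enters a new constant with its exact value. Where a constant with its exact
-- value is unfolded, there are two arguments. For `μ`, well-founded induction along `CompDep n`
-- applies: a leaf that returns to `n` carries a smaller state (`compDep_of_reach`), because every
-- reachability path decomposes into loops at successive companion nodes, which is what the extended
-- dependency ordering records (`extDep_of_reach`). For `ν`, coinduction applies to the set `X` of
-- all reachable states at which the constant is unfolded. Enlarging the value of the constant by
-- `X` spoils neither earlier constants, whose definitions do not mention it, nor later ones, which
-- no longer occur once the constant itself is the formula (`later_notMem_freeVars`).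

theorem parent_wf (t : OrderedTree N) : WellFounded (fun a b => t.parent b = some a) := by
  refine ⟨fun n => ?_⟩
  induction t.root_anc n with
  | refl =>
    refine ⟨_, fun a ha => ?_⟩
    rw [(t.parent_eq_none _).2 rfl] at ha
    cases ha
  | tail _ h ih =>
    refine ⟨_, fun a ha => ?_⟩
    rw [h] at ha
    cases ha
    exact ih

theorem not_transGen_self (t : OrderedTree N) (n : N) :
    ¬ Relation.TransGen (fun a b => t.parent b = some a) n n := fun h =>
  t.parent_wf.transGen.irrefl.irrefl n h

theorem strictAnc_iff_transGen (t : OrderedTree N) (m n : N) :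
    t.StrictAnc m n ↔ Relation.TransGen (fun a b => t.parent b = some a) m n := by
  constructor
  · rintro ⟨h, hne⟩
    rcases Relation.reflTransGen_iff_eq_or_transGen.1 h with h | h
    · exact absurd h.symm hne
    · exact h
  · intro h
    refine ⟨h.to_reflTransGen, ?_⟩
    rintro rfl
    exact t.not_transGen_self _ h

theorem Anc.refl (t : OrderedTree N) (n : N) : t.Anc n n := Relation.ReflTransGen.refl

theorem Anc.trans {t : OrderedTree N} {a b c : N} (h : t.Anc a b) (h' : t.Anc b c) :
    t.Anc a c := Relation.ReflTransGen.trans h h'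

theorem anc_of_parent {t : OrderedTree N} {a b : N} (h : t.parent b = some a) : t.Anc a b :=
  Relation.ReflTransGen.single h

theorem strictAnc_of_parent {t : OrderedTree N} {a b : N} (h : t.parent b = some a) :
    t.StrictAnc a b := (t.strictAnc_iff_transGen _ _).2 (Relation.TransGen.single h)

theorem StrictAnc.trans_anc {t : OrderedTree N} {a b c : N} (h : t.StrictAnc a b)
    (h' : t.Anc b c) : t.StrictAnc a c := by
  rw [strictAnc_iff_transGen] at *
  exact Relation.TransGen.trans_left h h'

theorem Anc.trans_strict {t : OrderedTree N} {a b c : N} (h : t.Anc a b)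
    (h' : t.StrictAnc b c) : t.StrictAnc a c := by
  rw [strictAnc_iff_transGen] at *
  exact Relation.TransGen.trans_right h h'

theorem not_strictAnc_of_anc {t : OrderedTree N} {a b : N} (h : t.Anc a b) :
    ¬ t.StrictAnc b a := fun h' =>
  (h.trans_strict h').2 rfl

/-- Parents are unique, so the ancestors of a node form a chain. -/
theorem anc_total {t : OrderedTree N} {a b c : N} (ha : t.Anc a c) (hb : t.Anc b c) :
    t.Anc a b ∨ t.Anc b a := by
  induction ha with
  | refl => exact Or.inr hb
  | tail h hp ih =>
    rcases Relation.ReflTransGen.cases_tail hb with h' | ⟨d, hd, hd'⟩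
    · subst h'
      exact Or.inl (h.tail hp)
    · rw [hp] at hd'
      cases hd'
      exact ih hd

theorem StrictAnc.anc_parent {t : OrderedTree N} {a b c : N} (h : t.StrictAnc a c)
    (hp : t.parent c = some b) : t.Anc a b := by
  rcases Relation.ReflTransGen.cases_tail h.1 with h' | ⟨d, hd, hd'⟩
  · exact absurd h'.symm h.2
  · rw [hp] at hd'
    cases hd'
    exact hd

/-- Induction on a finite tree in which every strict descendant comes first. -/
theorem descendant_induction [Finite N] (t : OrderedTree N) {P : N → Prop}
    (h : ∀ n, (∀ c, t.StrictAnc n c → P c) → P n) (n : N) : P n := by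
  have : IsTrans N (fun a b => t.StrictAnc b a) := ⟨fun _ _ _ hab hbc => hbc.trans_anc hab.1⟩
  have : Std.Irrefl (fun a b => t.StrictAnc b a) := ⟨fun _ ha => ha.2 rfl⟩
  exact (Finite.wellFounded_of_trans_of_irrefl (fun a b => t.StrictAnc b a)).induction n h

theorem exists_deepest [Finite N] (t : OrderedTree N) {l : N} {P : N → Prop}
    (hP : ∀ m, P m → t.Anc m l) (h : ∃ m, P m) : ∃ m, P m ∧ ∀ m', P m' → t.Anc m' m := by
  by_contra hcon
  push Not at hcon
  obtain ⟨m, hm⟩ := h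
  refine t.descendant_induction (P := fun m => ¬ P m) (fun n ih hn => ?_) m hm
  obtain ⟨m', hm', hna⟩ := hcon n hn
  refine ih m' ⟨(anc_total (hP n hn) (hP m' hm')).resolve_right hna, ?_⟩ hm'
  rintro rfl
  exact hna (Anc.refl t _)

end OrderedTree

-- Semantics: coincidence, monotonicity, substitution and fixpoints.

namespace Form

variable {Var Act St : Type*} [DecidableEq Var]

theorem sem_congr (T : TTS Act St) (Φ : Form Var Act) : ∀ {V V' : Valuation Var St},
    (∀ Z ∈ Φ.freeVars, V Z = V' Z) → Φ.sem T V = Φ.sem T V' := by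
  induction Φ with
  | var Z => exact fun h => h Z rfl
  | neg Φ ih => exact fun h => by simp only [sem]; rw [ih h]
  | and Φ Ψ ih₁ ih₂ | or Φ Ψ ih₁ ih₂ | rel Φ Ψ ih₁ ih₂ | til Φ Ψ ih₁ ih₂ =>
    intro V V' h
    simp only [sem]
    rw [ih₁ fun Z hZ => h Z (Or.inl hZ), ih₂ fun Z hZ => h Z (Or.inr hZ)]
  | box K Φ ih | dia K Φ ih => exact fun h => by simp only [sem]; rw [ih h]
  | fix k W Φ ih =>
    intro V V' h
    have key : ∀ S, Φ.sem T (Function.update V W S) = Φ.sem T (Function.update V' W S) := by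
      refine fun S => ih fun Z hZ => ?_
      by_cases hZW : Z = W
      · subst hZW; simp
      · simp [hZW, h Z ⟨hZ, hZW⟩]
    cases k <;> simp only [sem, key]

theorem sem_update_of_notMem (T : TTS Act St) {Φ : Form Var Act} {U : Var}
    (hU : U ∉ Φ.freeVars) (V : Valuation Var St) (S : Set St) :
    Φ.sem T (Function.update V U S) = Φ.sem T V := by
  refine sem_congr T Φ fun Z hZ => ?_
  rw [Function.update_of_ne]
  rintro rfl
  exact hU hZ

/-- Both polarities are treated at once because negation exchanges them; `bif` swaps the two sets
when the parity is odd. -/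
theorem sem_mono_of_parity (T : TTS Act St) (Z : Var) (Φ : Form Var Act) :
    ∀ (b : Bool) (V : Valuation Var St) (A B : Set St), A ⊆ B → Parity Z b Φ →
      Φ.sem T (Function.update V Z (bif b then A else B)) ⊆
        Φ.sem T (Function.update V Z (bif b then B else A)) := by
  induction Φ with
  | var W =>
    intro b V A B hAB h
    by_cases hW : W = Z
    · have := h hW
      subst this hW
      simpa [sem] using hAB
    · simp [sem, hW]
  | neg Φ ih =>
    intro b V A B hAB h
    have := ih (!b) V A B hAB h
    cases b <;> exact Set.compl_subset_compl.2 this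
  | and Φ Ψ ih₁ ih₂ =>
    exact fun b V A B hAB h => Set.inter_subset_inter (ih₁ b V A B hAB h.1) (ih₂ b V A B hAB h.2)
  | or Φ Ψ ih₁ ih₂ =>
    exact fun b V A B hAB h => Set.union_subset_union (ih₁ b V A B hAB h.1) (ih₂ b V A B hAB h.2)
  | box K Φ ih => exact fun b V A B hAB h s hs s' hs' => ih b V A B hAB h (hs s' hs')
  | dia K Φ ih =>
    rintro b V A B hAB h s ⟨s', hs, hs'⟩
    exact ⟨s', ih b V A B hAB h hs, hs'⟩
  | rel Φ Ψ ih₁ ih₂ =>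
    intro b V A B hAB h s hs d s' hd he
    refine ih₂ b V A B hAB h.2 (hs d s' hd ?_)
    exact Set.subset_eq_empty (Set.inter_subset_inter_right _ (ih₁ b V A B hAB h.1)) he
  | til Φ Ψ ih₁ ih₂ =>
    rintro b V A B hAB h s ⟨d, s', hd, hs, hs'⟩
    exact ⟨d, s', hd, hs.trans (ih₁ b V A B hAB h.1), ih₂ b V A B hAB h.2 hs'⟩
  | fix k W Φ ih =>
    intro b V A B hAB h
    by_cases hW : W = Z
    · subst hW
      cases k <;> simp [sem]
    · have key := fun S => ih b (Function.update V W S) A B hAB (h.resolve_left hW)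
      cases k
      · refine Set.sInter_subset_sInter fun S (hS : _ ⊆ S) => ?_
        refine Set.Subset.trans ?_ hS
        rw [Function.update_comm (Ne.symm hW), Function.update_comm (Ne.symm hW)]
        exact key S
      · refine Set.sUnion_subset_sUnion fun S (hS : S ⊆ _) => Set.Subset.trans hS ?_
        rw [Function.update_comm (Ne.symm hW), Function.update_comm (Ne.symm hW)]
        exact key S

theorem sem_mono (T : TTS Act St) {Z : Var} {Φ : Form Var Act} (h : PositiveIn Z Φ)
    (V : Valuation Var St) {A B : Set St} (hAB : A ⊆ B) :
    Φ.sem T (Function.update V Z A) ⊆ Φ.sem T (Function.update V Z B) :=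
  sem_mono_of_parity T Z Φ true V A B hAB h

theorem sem_subst (T : TTS Act St) {Z U : Var} (Φ : Form Var Act) :
    ∀ V : Valuation Var St, U ∉ Φ.boundVars →
      (Φ.subst Z U).sem T V = Φ.sem T (Function.update V Z (V U)) := by
  induction Φ with
  | var W =>
    intro V _
    by_cases hW : W = Z
    · simp [subst, sem, hW]
    · simp [subst, sem, hW]
  | neg Φ ih => exact fun V h => by simp only [subst, sem]; rw [ih V h]
  | and Φ Ψ ih₁ ih₂ | or Φ Ψ ih₁ ih₂ | rel Φ Ψ ih₁ ih₂ | til Φ Ψ ih₁ ih₂ =>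
    intro V h
    simp only [subst, sem]
    rw [ih₁ V fun hZ => h (Or.inl hZ), ih₂ V fun hZ => h (Or.inr hZ)]
  | box K Φ ih | dia K Φ ih => exact fun V h => by simp only [subst, sem]; rw [ih V h]
  | fix k W Φ ih =>
    intro V h
    have hUW : U ≠ W := fun e => h (Or.inl e)
    have hU : U ∉ Φ.boundVars := fun e => h (Or.inr e)
    by_cases hW : W = Z
    · subst hW
      cases k <;> simp [subst, sem]
    · have key : ∀ S, (Φ.subst Z U).sem T (Function.update V W S) =
          Φ.sem T (Function.update (Function.update V Z (V U)) W S) := by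
        intro S
        rw [ih _ hU, Function.update_of_ne hUW, Function.update_comm hW]
      cases k <;> simp [subst, sem, hW, key]

theorem freeVars_subst {Z U : Var} (Φ : Form Var Act) :
    (Φ.subst Z U).freeVars ⊆ Φ.freeVars \ {Z} ∪ {U} := by
  induction Φ with
  | var W =>
    by_cases hW : W = Z
    · simp [subst, freeVars, hW]
    · simp [subst, freeVars, hW]
  | neg Φ ih | box K Φ ih | dia K Φ ih => exact ih
  | and Φ Ψ ih₁ ih₂ | or Φ Ψ ih₁ ih₂ | rel Φ Ψ ih₁ ih₂ | til Φ Ψ ih₁ ih₂ =>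
    simp only [subst, freeVars]
    intro x hx
    have h₁ := @ih₁ x
    have h₂ := @ih₂ x
    simp only [Set.mem_union, Set.mem_sdiff, Set.mem_singleton_iff] at *
    tauto
  | fix k W Φ ih =>
    by_cases hW : W = Z
    · subst hW
      simp [subst, freeVars]
    · simp only [subst, hW, if_false, freeVars]
      intro x hx
      have := @ih x
      simp only [Set.mem_union, Set.mem_sdiff, Set.mem_singleton_iff] at *
      tauto

theorem sem_mu_unfold (T : TTS Act St) {Z : Var} {Φ : Form Var Act} (h : PositiveIn Z Φ)
    (V : Valuation Var St) :
    Φ.sem T (Function.update V Z ((fix .mu Z Φ).sem T V)) ⊆ (fix .mu Z Φ).sem T V :=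
  fun _ hs _ hS => hS (sem_mono T h V (Set.sInter_subset_of_mem hS) hs)

/-- By monotonicity the union of `X` with the greatest fixpoint is again a post-fixed point. The
hypothesis may therefore use the fixpoint as well as `X`. -/
theorem sem_nu_coinduction (T : TTS Act St) {Z : Var} {Φ : Form Var Act} (h : PositiveIn Z Φ)
    (V : Valuation Var St) {X : Set St}
    (hX : X ⊆ Φ.sem T (Function.update V Z ((fix .nu Z Φ).sem T V ∪ X))) :
    X ⊆ (fix .nu Z Φ).sem T V := by
  refine fun s hs => ⟨(fix .nu Z Φ).sem T V ∪ X, ?_, Or.inr hs⟩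
  refine Set.union_subset ?_ hX
  rintro t ⟨S, hS, ht⟩
  exact sem_mono T h V (Set.subset_union_of_subset_left (Set.subset_sUnion_of_mem hS) X) (hS ht)

end Form

-- Consequences of the definition list conditions.

namespace DefList

variable {Var Act : Type*} {Δ : DefList Var Act}

theorem IsDefList.pairwise (h : IsDefList Δ) : Δ.Pairwise fun p q => q.1 ∉ p.2.freeVars :=
  List.pairwise_iff_get.2 fun i j hij => h.not_free i j hij.le

theorem IsDefList.notMem_freeVars (h : IsDefList Δ) {p : Var × Form Var Act} (hp : p ∈ Δ) :
    p.1 ∉ p.2.freeVars := by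
  obtain ⟨i, rfl⟩ := List.mem_iff_get.1 hp
  exact h.not_free i i le_rfl

theorem IsDefList.unique (h : IsDefList Δ) {U : Var} {Φ Ψ : Form Var Act} (hΦ : (U, Φ) ∈ Δ)
    (hΨ : (U, Ψ) ∈ Δ) : Φ = Ψ := by
  have := List.inj_on_of_nodup_map h.nodup hΦ hΨ rfl
  exact (Prod.mk.inj this).2

end DefList

-- Labels along a branch.

namespace PartialTableau

variable {Var Act St N : Type*} [DecidableEq Var] {T : TTS Act St} {V : Valuation Var St}

open OrderedTree

theorem parent_of_mem_cs (𝕋 : PartialTableau T V N) {n c : N} (h : c ∈ 𝕋.tree.cs n) :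
    𝕋.tree.parent c = some n := (𝕋.tree.mem_cs n c).1 h

theorem exists_rule (𝕋 : PartialTableau T V N) {n c : N} (h : 𝕋.tree.parent c = some n) :
    ∃ a, 𝕋.rule n = some a := by
  by_contra hcon
  have hl := (𝕋.rule_eq_none n).1 (Option.eq_none_iff_forall_ne_some.2 fun a ha => hcon ⟨a, ha⟩)
  have hc := (𝕋.tree.mem_cs n c).2 h
  rw [hl] at hc
  cases hc

theorem not_isLeaf_of_rule (𝕋 : PartialTableau T V N) {n : N} {a : RuleAppl Act St}
    (h : 𝕋.rule n = some a) : ¬ 𝕋.tree.IsLeaf n := fun hl => by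
  rw [(𝕋.rule_eq_none n).2 hl] at h
  cases h

theorem exists_child (𝕋 : PartialTableau T V N) {n : N} {s : Sequent Var Act St}
    (h : (𝕋.tree.cs n).map 𝕋.lab = [s]) :
    ∃ c, 𝕋.tree.parent c = some n ∧ 𝕋.lab c = s := by
  obtain ⟨c, hc, hs⟩ := List.mem_map.1 (h ▸ List.mem_singleton_self s)
  exact ⟨c, 𝕋.parent_of_mem_cs hc, hs⟩

theorem exists_children (𝕋 : PartialTableau T V N) {n : N} {s₁ s₂ : Sequent Var Act St}
    (h : (𝕋.tree.cs n).map 𝕋.lab = [s₁, s₂]) :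
    ∃ c₁ c₂, 𝕋.tree.cs n = [c₁, c₂] ∧ 𝕋.tree.parent c₁ = some n ∧
      𝕋.tree.parent c₂ = some n ∧ 𝕋.lab c₁ = s₁ ∧ 𝕋.lab c₂ = s₂ := by
  obtain ⟨c₁, l, hl, h₁, h'⟩ := List.map_eq_cons_iff.1 h
  obtain ⟨c₂, l', rfl, h₂, h''⟩ := List.map_eq_cons_iff.1 h'
  rw [List.map_eq_nil_iff] at h''
  subst h''
  exact ⟨c₁, c₂, hl, 𝕋.parent_of_mem_cs (by simp [hl]), 𝕋.parent_of_mem_cs (by simp [hl]), h₁, h₂⟩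

theorem lab_child_mem (𝕋 : PartialTableau T V N) {n c : N} {l : List (Sequent Var Act St)}
    (h : 𝕋.tree.parent c = some n) (hl : (𝕋.tree.cs n).map 𝕋.lab = l) : 𝕋.lab c ∈ l :=
  hl ▸ List.mem_map_of_mem ((𝕋.tree.mem_cs n c).2 h)

/-- For tracking constants only two rules matter: a fixpoint rule extends the definition list, and
an unfolding imports the free variables of a definition. Every other rule can only lose free
variables. -/
theorem child_cases (𝕋 : PartialTableau T V N) {n c : N} (h : 𝕋.tree.parent c = some n) :
    ((𝕋.lab c).dl = (𝕋.lab n).dl ∧ (𝕋.lab c).fm.freeVars ⊆ (𝕋.lab n).fm.freeVars) ∨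
    (∃ k Z Φ U, 𝕋.rule n = some (.fix k) ∧ (𝕋.lab n).fm = .fix k Z Φ ∧
      (∀ m, ¬ 𝕋.tree.StrictAnc n m → U ∉ (𝕋.lab m).vars) ∧
      (𝕋.lab c).dl = (𝕋.lab n).dl ++ [(U, .fix k Z Φ)] ∧ (𝕋.lab c).fm = .var U) ∨
    (∃ U k Z Φ, 𝕋.rule n = some .un ∧ (𝕋.lab n).fm = .var U ∧ (U, .fix k Z Φ) ∈ (𝕋.lab n).dl ∧
      (𝕋.lab c).dl = (𝕋.lab n).dl ∧ (𝕋.lab c).fm = Φ.subst Z U) := by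
  obtain ⟨a, ha⟩ := 𝕋.exists_rule h
  have hap := 𝕋.applies n a ha
  cases a with
  | and | or | ex _ | all _ =>
    simp only [RuleAppl.Applies] at hap
    obtain ⟨Φ, Ψ, hap⟩ := hap
    have hfm : (𝕋.lab n).fm.freeVars = Φ.freeVars ∪ Ψ.freeVars := by
      first
        | rw [hap.1]; rfl
        | obtain ⟨_, _, hap⟩ := hap; rw [hap.1]; rfl
    have hl : ∃ S₁ S₂, (𝕋.tree.cs n).map 𝕋.lab =
        [⟨S₁, (𝕋.lab n).dl, Φ⟩, ⟨S₂, (𝕋.lab n).dl, Ψ⟩] := by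
      first
        | exact ⟨_, _, hap.2⟩
        | exact ⟨_, _, hap.2.2⟩
        | obtain ⟨_, _, hap⟩ := hap; exact ⟨_, _, hap.2.2⟩
    obtain ⟨S₁, S₂, hl⟩ := hl
    left
    have hc := 𝕋.lab_child_mem h hl
    rw [hfm]
    rcases List.mem_pair.1 hc with hc | hc <;> rw [hc]
    · exact ⟨rfl, Set.subset_union_left⟩
    · exact ⟨rfl, Set.subset_union_right⟩
  | box K =>
    obtain ⟨Φ, hfm, hl⟩ := hap
    left
    rw [List.mem_singleton.1 (𝕋.lab_child_mem h hl), hfm]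
    exact ⟨rfl, subset_rfl⟩
  | dia K f =>
    obtain ⟨Φ, hfm, -, hl⟩ := hap
    left
    rw [List.mem_singleton.1 (𝕋.lab_child_mem h hl), hfm]
    exact ⟨rfl, subset_rfl⟩
  | thin =>
    obtain ⟨S, -, hl⟩ := hap
    left
    rw [List.mem_singleton.1 (𝕋.lab_child_mem h hl)]
    exact ⟨rfl, subset_rfl⟩
  | fix k =>
    obtain ⟨Z, Φ, U, hfm, hU, hl⟩ := hap
    right; left
    refine ⟨k, Z, Φ, U, ha, hfm, hU, ?_⟩
    rw [List.mem_singleton.1 (𝕋.lab_child_mem h hl)]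
    exact ⟨rfl, rfl⟩
  | un =>
    obtain ⟨U, k, Z, Φ, hfm, hU, hl⟩ := hap
    right; right
    refine ⟨U, k, Z, Φ, ha, hfm, hU, ?_⟩
    rw [List.mem_singleton.1 (𝕋.lab_child_mem h hl)]
    exact ⟨rfl, rfl⟩

theorem dl_prefix (𝕋 : PartialTableau T V N) {n k : N} (h : 𝕋.tree.Anc n k) :
    (𝕋.lab n).dl <+: (𝕋.lab k).dl := by
  induction h with
  | refl => exact List.prefix_rfl
  | tail _ hp ih =>
    rcases 𝕋.child_cases hp with h | ⟨_, _, _, _, -, -, -, h, -⟩ | ⟨_, _, _, _, -, -, -, h, -⟩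
    · rwa [h.1]
    · rw [h]
      exact ih.trans (List.prefix_append _ _)
    · rwa [h]

/-- Below a node labelled by a constant, no later constant of its definition list occurs. -/
theorem later_notMem_freeVars (𝕋 : PartialTableau T V N) {j k : N} (h : 𝕋.tree.Anc j k)
    {W : Var} (hW : (𝕋.lab j).fm = .var W) {L₁ L₂ : DefList Var Act} {Ψ : Form Var Act}
    (hdl : (𝕋.lab j).dl = L₁ ++ (W, Ψ) :: L₂) {p : Var × Form Var Act} (hp : p ∈ L₂) :
    p.1 ∉ (𝕋.lab k).fm.freeVars := by
  -- The invariant must also cover the definitions: unfolding a constant outside `L₂` puts its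
  -- definition into the formula, and a fixpoint rule turns the current formula into a definition.
  suffices H : (∀ U ∈ DefList.dom L₂, U ∉ (𝕋.lab k).fm.freeVars) ∧
      ∀ q ∈ (𝕋.lab k).dl, q.1 ∉ DefList.dom L₂ → ∀ U ∈ DefList.dom L₂, U ∉ q.2.freeVars from
    H.1 p.1 ⟨p.2, hp⟩
  have hD := (𝕋.isSequent j).isDefList
  have hsub : ∀ k, 𝕋.tree.Anc j k → ∀ U ∈ DefList.dom L₂, U ∈ DefList.dom (𝕋.lab k).dl := by
    rintro k hk U ⟨Θ, hU⟩
    refine ⟨Θ, (𝕋.dl_prefix hk).subset ?_⟩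
    rw [hdl]
    simp [hU]
  have hpw := hD.pairwise
  have hnd := hD.nodup
  rw [hdl] at hpw hnd
  induction h with
  | refl =>
    refine ⟨?_, ?_⟩
    · rintro U ⟨Θ, hU⟩ hUW
      rw [hW] at hUW
      rw [List.map_append, List.map_cons, List.nodup_append, List.nodup_cons] at hnd
      exact hnd.2.1.1 (List.mem_map.2 ⟨(U, Θ), hU, hUW⟩)
    · rintro q hq hq' U ⟨Θ, hU⟩
      rw [hdl, List.mem_append, List.mem_cons] at hq
      rw [List.pairwise_append, List.pairwise_cons] at hpw
      rcases hq with hq | rfl | hq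
      · exact hpw.2.2 q hq (U, Θ) (List.mem_cons_of_mem _ hU)
      · exact hpw.2.1.1 (U, Θ) hU
      · exact absurd ⟨q.2, hq⟩ hq'
  | @tail b c hb hp ih =>
    rcases 𝕋.child_cases hp with h | ⟨k, Z, Φ, U', -, hfm, hfr, hd, hf⟩ |
      ⟨U', k, Z, Φ, -, hfm, hU', hd, hf⟩
    · rw [h.1]
      exact ⟨fun U hU hU' => ih.1 U hU (h.2 hU'), ih.2⟩
    · rw [hd, hf]
      refine ⟨?_, ?_⟩
      · rintro U hU (rfl : U = U')
        exact hfr b (fun h => h.2 rfl) (Or.inl (Or.inr (hsub b hb U hU)))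
      · intro q hq hq' U hU
        rcases List.mem_append.1 hq with hq | hq
        · exact ih.2 q hq hq' U hU
        · rw [List.mem_singleton.1 hq]
          rw [hfm] at ih
          exact ih.1 U hU
    · rw [hd, hf]
      refine ⟨fun U hU hU₂ => ?_, ih.2⟩
      -- The unfolded constant is the current formula, so by the invariant it is not one of the
      -- later ones.
      have hUne : U' ∉ DefList.dom L₂ := fun h' => by
        have := ih.1 U' h'
        rw [hfm] at this
        exact this rfl
      rcases Form.freeVars_subst Φ hU₂ with h | h
      · exact ih.2 _ hU' hUne U hU h
      · cases h
        exact hUne hU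

-- Dependency orderings and reachability.

theorem LocalDep.mem {𝕋 : PartialTableau T V N} {n c : N} {s s' : St}
    (h : 𝕋.LocalDep c n s' s) : s' ∈ (𝕋.lab c).st := h.2.1

theorem Dep.anc {𝕋 : PartialTableau T V N} {n c : N} {s s' : St} (h : 𝕋.Dep c n s' s) :
    𝕋.tree.Anc n c := by
  induction h with
  | refl _ => exact Anc.refl _ _
  | step _ h ih => exact (anc_of_parent h.1).trans ih

theorem ExtDep.comp_localDep {𝕋 : PartialTableau T V N} {n c k : N} {s t u : St}
    (h : 𝕋.ExtDep k c u t) (hl : 𝕋.LocalDep c n t s) : 𝕋.ExtDep k n u s := by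
  cases h with
  | base h => exact .base (h.step hl)
  | step hm _ hk h₁ h₂ h₃ =>
    refine .step hm ?_ hk h₁ h₂ (h₃.step hl)
    rintro rfl
    exact not_strictAnc_of_anc h₃.anc (strictAnc_of_parent hl.1)

theorem compDepPlus_of_transGen {𝕋 : PartialTableau T V N} {m : N} {s s' : St}
    (h : Relation.TransGen (𝕋.CompDep m) s' s) : 𝕋.CompDepPlus m s' s := by
  induction h with
  | single h => exact .single h
  | tail _ h ih => exact .tail ih h

/-- Reachability of configurations by the local dependency ordering and by jumps from companion
leaves to their companion nodes, where only jumps to nodes in `P` are allowed. -/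
inductive Reach (𝕋 : PartialTableau T V N) (P : N → Prop) (n : N) (s : St) : N → St → Prop where
  | refl : Reach 𝕋 P n s n s
  | down {m k : N} {t u : St} :
      Reach 𝕋 P n s m t → 𝕋.LocalDep k m u t → Reach 𝕋 P n s k u
  | jump {l m : N} {t : St} :
      Reach 𝕋 P n s l t → 𝕋.IsCompanionLeaf m l → P m → Reach 𝕋 P n s m t

namespace Reach

variable {𝕋 : PartialTableau T V N} {P Q : N → Prop} {n m k : N} {s t u : St}

theorem trans (h : 𝕋.Reach P n s m t) (h' : 𝕋.Reach P m t k u) : 𝕋.Reach P n s k u := by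
  induction h' with
  | refl => exact h
  | down _ hl ih => exact ih.down hl
  | jump _ hl hP ih => exact ih.jump hl hP

theorem mono (hPQ : ∀ m, P m → Q m) (h : 𝕋.Reach P n s k u) : 𝕋.Reach Q n s k u := by
  induction h with
  | refl => exact .refl
  | down _ hl ih => exact ih.down hl
  | jump _ hl hP ih => exact ih.jump hl (hPQ _ hP)

theorem mem (h : 𝕋.Reach P n s k u) (hs : s ∈ (𝕋.lab n).st) : u ∈ (𝕋.lab k).st := by
  induction h with
  | refl => exact hs
  | down _ hl _ => exact hl.mem
  | jump _ hl _ ih => exact hl.2.1.2.2.2 ih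

theorem anc (h : 𝕋.Reach P n s k u) (hP : ∀ m, P m → 𝕋.tree.Anc n m) : 𝕋.tree.Anc n k := by
  induction h with
  | refl => exact Anc.refl _ _
  | down _ hl ih => exact ih.trans (anc_of_parent hl.1)
  | jump _ _ h _ => exact hP _ h

/-- Reachability inside the subtree of a child yields reachability inside that of its parent. -/
theorem of_child (hl : 𝕋.LocalDep m n t s) (h : 𝕋.Reach (𝕋.tree.Anc m) m t k u) :
    𝕋.Reach (𝕋.tree.StrictAnc n) n s k u :=
  (Reach.refl.down hl).trans (h.mono fun _ hm => (strictAnc_of_parent hl.1).trans_anc hm)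

/-- A jump made below a child `c` targets an ancestor of a node below `c` that is itself strictly
below `n`, hence a node of the subtree of `c`. A path thus never leaves the subtree of its first
child. -/
theorem exists_child (h : 𝕋.Reach (𝕋.tree.StrictAnc n) n s k u) :
    (k = n ∧ u = s) ∨ ∃ c t, 𝕋.LocalDep c n t s ∧ 𝕋.Reach (𝕋.tree.Anc c) c t k u := by
  induction h with
  | refl => exact Or.inl ⟨rfl, rfl⟩
  | down _ hl ih =>
    rcases ih with ⟨rfl, rfl⟩ | ⟨c, t, h₁, h₂⟩
    · exact Or.inr ⟨_, _, hl, .refl⟩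
    · exact Or.inr ⟨c, t, h₁, h₂.down hl⟩
  | @jump l m _ _ hl hP ih =>
    rcases ih with ⟨rfl, rfl⟩ | ⟨c, t, h₁, h₂⟩
    · exact absurd hP (not_strictAnc_of_anc hl.2.1.2.1.1)
    · refine Or.inr ⟨c, t, h₁, h₂.jump hl ?_⟩
      rcases anc_total (h₂.anc fun _ h => h) hl.2.1.2.1.1 with h | h
      · exact h
      · by_cases he : m = c
        · exact he ▸ Anc.refl _ _
        · exact absurd (StrictAnc.anc_parent ⟨h, he⟩ h₁.1) fun h' => not_strictAnc_of_anc h' hP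

end Reach

/-- After the first step, to a child `c`, the path is cut at its jumps to `c`. Each loop is a
`CompDep c` step by induction, and the last segment jumps only strictly below `c`. This is the shape
of `ExtDep.step`. -/
theorem extDep_of_reach [Finite N] (𝕋 : PartialTableau T V N) (n : N) :
    ∀ (s : St) (l : N) (u : St), s ∈ (𝕋.lab n).st → 𝕋.tree.IsLeaf l →
      𝕋.Reach (𝕋.tree.StrictAnc n) n s l u → 𝕋.ExtDep l n u s := by
  induction n using 𝕋.tree.descendant_induction with
  | h n ih =>
    intro s l u hs hl h
    rcases h.exists_child with ⟨rfl, rfl⟩ | ⟨c, t, hc, hr⟩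
    · exact .base (.refl hs)
    · have ihc := ih c (strictAnc_of_parent hc.1)
      -- `w` is the state at the last visit to `c`: either no jump to `c` has occurred, or the loops
      -- at `c` lead from `t` down to `w`.
      have key : ∀ k v, 𝕋.Reach (𝕋.tree.Anc c) c t k v → ∃ w,
          (w = t ∨ 𝕋.IsCompanionNode c ∧ Relation.TransGen (𝕋.CompDep c) w t) ∧
            𝕋.Reach (𝕋.tree.StrictAnc c) c w k v ∧ w ∈ (𝕋.lab c).st := by
        intro k v hkv
        induction hkv with
        | refl => exact ⟨t, Or.inl rfl, .refl, hc.mem⟩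
        | down _ hd ih' =>
          obtain ⟨w, hw, hw', hwm⟩ := ih'
          exact ⟨w, hw, hw'.down hd, hwm⟩
        | @jump k m v _ hj hm ih' =>
          obtain ⟨w, hw, hw', hwm⟩ := ih'
          by_cases he : c = m
          · subst he
            have hd : 𝕋.CompDep c v w := .intro hj.2.1.1 hwm (hj.2.1.2.2.2 (hw'.mem hwm)) hj
              (hw'.mem hwm) (ihc w k v hwm hj.1 hw')
            refine ⟨v, Or.inr ⟨hj.2.1.1, ?_⟩, .refl, hj.2.1.2.2.2 (hw'.mem hwm)⟩
            rcases hw with rfl | ⟨-, hw⟩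
            · exact .single hd
            · exact hw.head hd
          · exact ⟨w, hw, hw'.jump hj ⟨hm, he⟩, hwm⟩
      obtain ⟨w, hw, hr', hwm⟩ := key l u hr
      have he := ihc w l u hwm hl hr'
      rcases hw with rfl | ⟨hcn, hw⟩
      · exact he.comp_localDep hc
      · refine .step hcn (strictAnc_of_parent hc.1).2.symm ?_ he (compDepPlus_of_transGen hw)
          ((Dep.refl hc.mem).step hc)
        rintro rfl
        exact 𝕋.not_isLeaf_of_rule hcn hl

/-- A configuration that is reached again at a companion leaf is smaller in the ordering of the
companion node. -/
theorem compDep_of_reach [Finite N] {𝕋 : PartialTableau T V N} {n l : N} {s u : St}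
    (hs : s ∈ (𝕋.lab n).st) (hl : 𝕋.IsCompanionLeaf n l)
    (h : 𝕋.Reach (𝕋.tree.StrictAnc n) n s l u) : 𝕋.CompDep n u s :=
  .intro hl.2.1.1 hs (hl.2.1.2.2.2 (h.mem hs)) hl (h.mem hs) (𝕋.extDep_of_reach n s l u hs hl.1 h)

-- Soundness at the individual nodes.

/-- Local soundness of the rules other than those for fixpoints. -/
theorem mem_sem_of_children (𝕋 : PartialTableau T V N) {n : N} {a : RuleAppl Act St}
    (ha : 𝕋.rule n = some a) (hun : a ≠ .un) (hfix : ∀ k, a ≠ .fix k) {ρ : Valuation Var St}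
    {s : St} (hs : s ∈ (𝕋.lab n).st)
    (h : ∀ c s', 𝕋.LocalDep c n s' s → s' ∈ (𝕋.lab c).fm.sem T ρ) :
    s ∈ (𝕋.lab n).fm.sem T ρ := by
  have hap := 𝕋.applies n a ha
  cases a with
  | un => exact absurd rfl hun
  | fix k => exact absurd rfl (hfix k)
  | and =>
    obtain ⟨Φ, Ψ, hfm, hl⟩ := hap
    obtain ⟨c₁, c₂, hcs, hp₁, hp₂, h₁, h₂⟩ := 𝕋.exists_children hl
    rw [hfm]
    have h₁' := h c₁ s ⟨hp₁, by rwa [h₁], hs, by simp only [ha]⟩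
    have h₂' := h c₂ s ⟨hp₂, by rwa [h₂], hs, by simp only [ha]⟩
    rw [h₁] at h₁'
    rw [h₂] at h₂'
    exact ⟨h₁', h₂'⟩
  | or =>
    obtain ⟨Φ, Ψ, S₁, S₂, hfm, hS, hl⟩ := hap
    obtain ⟨c₁, c₂, hcs, hp₁, hp₂, h₁, h₂⟩ := 𝕋.exists_children hl
    rw [hfm]
    rcases (hS ▸ hs : s ∈ S₁ ∪ S₂) with hs' | hs'
    · have h₁' := h c₁ s ⟨hp₁, by rwa [h₁], hs, by simp only [ha]⟩
      rw [h₁] at h₁'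
      exact Or.inl h₁'
    · have h₂' := h c₂ s ⟨hp₂, by rwa [h₂], hs, by simp only [ha]⟩
      rw [h₂] at h₂'
      exact Or.inr h₂'
  | box K =>
    obtain ⟨Φ, hfm, hl⟩ := hap
    obtain ⟨c, hp, hc⟩ := 𝕋.exists_child hl
    rw [hfm]
    intro s' hs'
    have := h c s' ⟨hp, by rw [hc]; exact ⟨s, hs, hs'⟩, hs, by simpa only [ha] using hs'⟩
    rwa [hc] at this
  | dia K f =>
    obtain ⟨Φ, hfm, hf, hl⟩ := hap
    obtain ⟨c, hp, hc⟩ := 𝕋.exists_child hl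
    rw [hfm]
    have := h c (f s) ⟨hp, by rw [hc]; exact ⟨s, hs, rfl⟩, hs, by simp only [ha]⟩
    rw [hc] at this
    exact ⟨f s, this, hf s hs⟩
  | thin =>
    obtain ⟨S, hS, hl⟩ := hap
    obtain ⟨c, hp, hc⟩ := 𝕋.exists_child hl
    have := h c s ⟨hp, by rw [hc]; exact hS hs, hs, by simp only [ha]⟩
    rwa [hc] at this
  | ex f =>
    obtain ⟨Φ, Ψ, hfm, hf, hl⟩ := hap
    obtain ⟨c₁, c₂, hcs, hp₁, hp₂, h₁, h₂⟩ := 𝕋.exists_children hl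
    rw [hfm]
    obtain ⟨s', hs'⟩ := hf s hs
    refine ⟨f s, s', hs', fun y hy => ?_, ?_⟩
    · have := h c₁ y ⟨hp₁, by rw [h₁]; exact Set.mem_biUnion hs hy, hs, by
        simp only [ha]; exact ⟨c₁, c₂, hcs, Or.inl ⟨rfl, hy⟩⟩⟩
      rwa [h₁] at this
    · have := h c₂ s' ⟨hp₂, by rw [h₂]; exact ⟨s, hs, hs'⟩, hs, by
        simp only [ha]; exact ⟨c₁, c₂, hcs, Or.inr ⟨rfl, hs'⟩⟩⟩
      rwa [h₂] at this
  | all g =>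
    obtain ⟨Φ, Ψ, hfm, hg, hl⟩ := hap
    obtain ⟨c₁, c₂, hcs, hp₁, hp₂, h₁, h₂⟩ := 𝕋.exists_children hl
    rw [hfm]
    intro d s' hd he
    have hdel : d ∈ T.delays s := ⟨s', hd⟩
    rcases (hg s hs d hdel).lt_or_eq with hlt | heq
    · obtain ⟨y, hy, -⟩ := T.time_continuous s s' d hd (g s d) (d - g s d)
        (add_tsub_cancel_of_le hlt.le).symm
      have := h c₁ y ⟨hp₁, by rw [h₁]; exact ⟨s, hs, d, hdel, hlt, hy⟩, hs, by
        simp only [ha]; exact ⟨c₁, c₂, hcs, Or.inl ⟨rfl, d, hdel, hlt, hy⟩⟩⟩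
      rw [h₁] at this
      exact absurd ⟨⟨g s d, hlt, hy⟩, this⟩ (Set.eq_empty_iff_forall_notMem.1 he y)
    · have hy : T.Delay s (g s d) s' := by rwa [heq]
      have := h c₂ s' ⟨hp₂, by rw [h₂]; exact ⟨s, hs, d, hdel, heq, hy⟩, hs, by
        simp only [ha]; exact ⟨c₁, c₂, hcs, Or.inr ⟨rfl, d, hdel, heq, hy⟩⟩⟩
      rwa [h₂] at this

theorem exists_companion [Finite N] (𝕋 : PartialTableau T V N) {n m : N}
    (hl : 𝕋.tree.IsLeaf n) (h : 𝕋.Candidate m n) : ∃ m, 𝕋.IsCompanionLeaf m n := by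
  obtain ⟨m, hm, hd⟩ := 𝕋.tree.exists_deepest (P := fun m => 𝕋.Candidate m n)
    (fun m h => h.2.1.1) ⟨m, h⟩
  exact ⟨m, hl, hm, hd⟩

/-- A companion leaf of `n` carries the same constant, whose definition is unique, so success can
only come from the `μ` clause. Without companion leaves the ordering is empty. -/
theorem wellFounded_compDep (𝕋 : PartialTableau T V N) (hsucc : 𝕋.IsSuccessful) {n : N}
    {U Z : Var} {Φ : Form Var Act} (hfm : (𝕋.lab n).fm = .var U)
    (hU : (U, .fix .mu Z Φ) ∈ (𝕋.lab n).dl) : WellFounded (𝕋.CompDep n) := by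
  by_cases hex : ∃ l, 𝕋.IsCompanionLeaf n l
  · obtain ⟨l, hl⟩ := hex
    have hUl : (U, .fix .mu Z Φ) ∈ (𝕋.lab l).dl := (𝕋.dl_prefix hl.2.1.2.1.1).subset hU
    have hfl : (𝕋.lab l).fm = .var U := hl.2.1.2.2.1.symm.trans hfm
    rcases hsucc.2 l hl.1 with ⟨Z', hZ, hf, -⟩ | ⟨Z', hZ, hf, -⟩ |
      ⟨-, U', hf, ⟨Z', Φ', hm⟩, -⟩ | ⟨-, h⟩
    · rw [hfl] at hf
      cases hf
      exact absurd ⟨_, hUl⟩ hZ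
    · rw [hfl] at hf
      cases hf
    · rw [hfl] at hf
      cases hf
      cases (𝕋.isSequent l).isDefList.unique hm hUl
    · exact h n hl
  · refine ⟨fun s => ⟨_, fun t ht => ?_⟩⟩
    cases ht with
    | intro _ _ _ hl _ _ => exact absurd ⟨_, hl⟩ hex

/-- The assumptions on a valuation under which the formula at `n` is shown to hold in `s`. -/
structure Supports (𝕋 : PartialTableau T V N) (ρ : Valuation Var St) (n : N) (s : St) :
    Prop where
  off_dom : ∀ Z, Z ∉ DefList.dom (𝕋.lab n).dl → ρ Z = V Z
  const : ∀ U Ψ, (U, Ψ) ∈ (𝕋.lab n).dl → ρ U = Ψ.sem T ρ ∨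
    ∀ k t, 𝕋.IsCompanionNode k → (𝕋.lab k).fm = .var U →
      𝕋.Reach (𝕋.tree.Anc n) n s k t → t ∈ ρ U
  leaf : ∀ j l t, 𝕋.IsCompanionLeaf j l → 𝕋.tree.StrictAnc j n →
    𝕋.Reach (𝕋.tree.Anc n) n s l t → t ∈ (𝕋.lab l).fm.sem T ρ

/-- The only strict ancestor of `c` that is not strictly above `n` is `n` itself; as `n` is not a
companion node, the leaf clause gains no new obligation. -/
theorem Supports.child {𝕋 : PartialTableau T V N} {ρ : Valuation Var St} {n c : N} {s t : St}
    (h : 𝕋.Supports ρ n s) (hn : ¬ 𝕋.IsCompanionNode n) (hl : 𝕋.LocalDep c n t s)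
    (hdl : (𝕋.lab c).dl = (𝕋.lab n).dl) : 𝕋.Supports ρ c t where
  off_dom := hdl ▸ h.off_dom
  const U Ψ hU := (h.const U Ψ (hdl ▸ hU)).imp_right fun H k u hk hf hr =>
    H k u hk hf ((hr.of_child hl).mono fun _ h => h.1)
  leaf j l u hj hjc hr := by
    refine h.leaf j l u hj ⟨hjc.anc_parent hl.1, ?_⟩ ((hr.of_child hl).mono fun _ h => h.1)
    rintro rfl
    exact hn hj.2.1.1

/-- Soundness at a node where a constant for a least fixpoint is unfolded. -/
theorem mem_sem_of_mu_unfold [Finite N] (𝕋 : PartialTableau T V N) (hsucc : 𝕋.IsSuccessful)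
    {n c : N} {U Z : Var} {Φ : Form Var Act} (hun : 𝕋.rule n = some .un)
    (hfm : (𝕋.lab n).fm = .var U) (hU : (U, .fix .mu Z Φ) ∈ (𝕋.lab n).dl)
    (hp : 𝕋.tree.parent c = some n) (hc : 𝕋.lab c = ⟨(𝕋.lab n).st, (𝕋.lab n).dl, Φ.subst Z U⟩)
    (ih : ∀ ρ t, t ∈ (𝕋.lab c).st → 𝕋.Supports ρ c t → t ∈ (𝕋.lab c).fm.sem T ρ)
    {ρ : Valuation Var St} (hρ : ρ U = (Form.fix .mu Z Φ).sem T ρ) (s : St)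
    (hs : s ∈ (𝕋.lab n).st) (h : 𝕋.Supports ρ n s) : s ∈ (𝕋.lab n).fm.sem T ρ := by
  have hD := (𝕋.isSequent n).isDefList
  have hUb : U ∉ Φ.boundVars := fun hb => hD.not_bound _ hU _ hU (Or.inr hb)
  induction s using (𝕋.wellFounded_compDep hsucc hfm hU).induction with
  | _ s ihs =>
    have hld : 𝕋.LocalDep c n s s := ⟨hp, by rwa [hc], hs, by simp only [hun]⟩
    have hsc : 𝕋.Supports ρ c s := by
      refine ⟨by rw [hc]; exact h.off_dom, ?_, ?_⟩
      · rw [hc]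
        exact fun W Ψ hW => (h.const W Ψ hW).imp_right fun H k u hk hf hr =>
          H k u hk hf ((hr.of_child hld).mono fun _ h => h.1)
      · intro j l u hj hjc hr
        have hr' := hr.of_child hld
        -- The one new obligation concerns leaves returning to `n`: their states are smaller in
        -- `CompDep n`, and the support conditions pass to them because they are reachable from `s`.
        by_cases hjn : j = n
        · subst hjn
          have hcd := compDep_of_reach hs hj hr'
          have hu : u ∈ (𝕋.lab j).st := hj.2.1.2.2.2 (hr'.mem hs)
          rw [← hj.2.1.2.2.1]
          have hru : 𝕋.Reach (𝕋.tree.Anc j) j s j u :=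
            (hr'.mono fun _ h => h.1).jump hj (Anc.refl _ _)
          exact ihs u hcd hu
            ⟨h.off_dom, fun W Ψ hW => (h.const W Ψ hW).imp_right fun H k v hk hf hv =>
              H k v hk hf (hru.trans hv),
              fun j' l' v hj' hjs hv => h.leaf j' l' v hj' hjs (hru.trans hv)⟩
        · exact h.leaf j l u hj ⟨hjc.anc_parent hp, hjn⟩ (hr'.mono fun _ h => h.1)
    have := ih ρ s hld.mem hsc
    rw [hc, Form.sem_subst T Φ ρ hUb, hρ] at this
    rw [hfm]
    change s ∈ ρ U
    rw [hρ]
    exact Form.sem_mu_unfold T (hD.wellFormed _ hU).1 ρ this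

/-- Soundness at a node where a constant for a greatest fixpoint is unfolded. -/
theorem mem_sem_of_nu_unfold (𝕋 : PartialTableau T V N)
    {n : N} {U Z : Var} {Φ : Form Var Act} (hun : 𝕋.rule n = some .un)
    (hfm : (𝕋.lab n).fm = .var U) (hU : (U, .fix .nu Z Φ) ∈ (𝕋.lab n).dl)
    (ih : ∀ c, 𝕋.tree.StrictAnc n c → ∀ ρ t, t ∈ (𝕋.lab c).st → 𝕋.Supports ρ c t →
      t ∈ (𝕋.lab c).fm.sem T ρ)
    {ρ : Valuation Var St} (hρ : ρ U = (Form.fix .nu Z Φ).sem T ρ) (s : St)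
    (hs : s ∈ (𝕋.lab n).st) (h : 𝕋.Supports ρ n s) : s ∈ (𝕋.lab n).fm.sem T ρ := by
  have hD := (𝕋.isSequent n).isDefList
  have hUb : U ∉ Φ.boundVars := fun hb => hD.not_bound _ hU _ hU (Or.inr hb)
  have hUZ : U ≠ Z := fun hb => hD.not_bound _ hU _ hU (Or.inl hb)
  have hUf : U ∉ Φ.freeVars := fun hf => hD.notMem_freeVars hU ⟨hf, hUZ⟩
  -- `X` collects unfoldings of `U` at all nodes `k` below `n`, not only at `n`. The tree induction
  -- hypothesis is then used at the child of `k`, still a strict descendant of `n`.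
  set X : Set St := {t | ∃ k, 𝕋.IsCompanionNode k ∧ (𝕋.lab k).fm = .var U ∧
    𝕋.Reach (𝕋.tree.Anc n) n s k t} with hX
  suffices hXρ : X ⊆ (Form.fix .nu Z Φ).sem T ρ by
    rw [hfm]
    change s ∈ ρ U
    rw [hρ]
    exact hXρ ⟨n, hun, hfm, .refl⟩
  refine Form.sem_nu_coinduction T (hD.wellFormed _ hU).1 ρ ?_
  rintro t ⟨k, hk, hfk, hr⟩
  have hnk : 𝕋.tree.Anc n k := hr.anc fun _ h => h
  have htk : t ∈ (𝕋.lab k).st := hr.mem hs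
  have hUk := (𝕋.dl_prefix hnk).subset hU
  obtain ⟨U', _, Z', Φ', hfk', hUk', hl⟩ := 𝕋.applies k _ hk
  obtain rfl : U = U' := by
    rw [hfk] at hfk'
    cases hfk'
    rfl
  cases (𝕋.isSequent k).isDefList.unique hUk hUk'
  obtain ⟨c, hp, hc⟩ := 𝕋.exists_child hl
  obtain ⟨M₁, M₂, hM⟩ := List.append_of_mem hU
  obtain ⟨M₃, hM₃⟩ := 𝕋.dl_prefix hnk
  have hMk : (𝕋.lab k).dl = M₁ ++ (U, .fix .nu Z Φ) :: (M₂ ++ M₃) := by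
    rw [← hM₃, hM]
    simp
  have hld : 𝕋.LocalDep c k t t := by
    have hk' : 𝕋.rule k = some .un := hk
    exact ⟨hp, by rwa [hc], htk, by simp only [hk']⟩
  set ρ' := Function.update ρ U (ρ U ∪ X) with hρ'
  have hle : ∀ W, ρ W ⊆ ρ' W := by
    intro W
    by_cases hW : W = U
    · subst hW
      simp [hρ']
    · simp [hρ', hW]
  have hXU : X ⊆ ρ' U := by simp [hρ']
  have hreach : ∀ {l u}, 𝕋.Reach (𝕋.tree.Anc c) c t l u → 𝕋.Reach (𝕋.tree.Anc n) n s l u :=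
    fun hu => hr.trans ((hu.of_child hld).mono fun _ h => hnk.trans h.1)
  have hkc := strictAnc_of_parent hp
  have hsc : 𝕋.Supports ρ' c t := by
    refine ⟨?_, ?_, ?_⟩
    · intro W hW
      rw [hc] at hW
      have hne : W ≠ U := by
        rintro rfl
        exact hW ⟨_, hUk⟩
      rw [hρ', Function.update_of_ne hne]
      refine h.off_dom W fun ⟨Θ, hΘ⟩ => hW ⟨Θ, ?_⟩
      exact (𝕋.dl_prefix hnk).subset hΘ
    · intro W Ψ hW
      rw [hc] at hW
      change (W, Ψ) ∈ (𝕋.lab k).dl at hW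
      by_cases hWU : W = U
      · subst hWU
        exact Or.inr fun k' u hk' hf hu => hXU ⟨k', hk', hf, hreach hu⟩
      rw [hMk, List.mem_append, List.mem_cons] at hW
      rcases hW with hW | hW | hW
      -- Earlier constants: their definitions do not contain `U`, so both alternatives survive the
      -- update.
      · have hpw := hD.pairwise
        rw [hM, List.pairwise_append] at hpw
        have hf := hpw.2.2 _ hW _ List.mem_cons_self
        rw [hρ', Function.update_of_ne hWU, Form.sem_update_of_notMem T hf]
        refine (h.const W Ψ (by rw [hM]; simp [hW])).imp_right fun H k' u hk' hf' hu => ?_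
        exact H k' u hk' hf' (hreach hu)
      · exact absurd (Prod.mk.inj hW).1 hWU
      -- Later constants: the second alternative is vacuous, since no node below `k` is labelled by
      -- one of them.
      · refine Or.inr fun k' u hk' hf hu => ?_
        have := 𝕋.later_notMem_freeVars (hkc.1.trans (hu.anc fun _ h => h)) hfk hMk hW
        rw [hf] at this
        exact absurd rfl this
    · intro j l u hj hjc hu
      have hjk := hjc.anc_parent hp
      have hcl : 𝕋.tree.Anc c l := hu.anc fun _ h => h
      obtain ⟨W, _, _, _, hfj, hWj, -⟩ := 𝕋.applies j _ hj.2.1.1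
      have hfl : (𝕋.lab l).fm = .var W := hj.2.1.2.2.1.symm.trans hfj
      rw [hfl]
      change u ∈ ρ' W
      by_cases hjn : 𝕋.tree.StrictAnc j n
      · have := h.leaf j l u hj hjn (hreach hu)
        rw [hfl] at this
        exact hle W this
      · have hnj : 𝕋.tree.Anc n j := by
          rcases anc_total hnk hjk with h' | h'
          · exact h'
          · by_cases he : j = n
            · exact he ▸ Anc.refl _ _
            · exact absurd ⟨h', he⟩ hjn
        -- The companion `j` lies between `n` and `k`. Were `W` earlier than `U`, then `U` could not
        -- label `k`, which is below `j`; were it later, `W` could not label `l`, which is below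
        -- `k`.
        have hWU : W = U := by
          by_contra hWU
          obtain ⟨M₄, hM₄⟩ := 𝕋.dl_prefix hnj
          have hMj : (𝕋.lab j).dl = M₁ ++ (U, .fix .nu Z Φ) :: (M₂ ++ M₄) := by
            rw [← hM₄, hM]
            simp
          have hWj' := hWj
          rw [hMj, List.mem_append, List.mem_cons] at hWj'
          rcases hWj' with hW | hW | hW
          · obtain ⟨A, B, rfl⟩ := List.append_of_mem hW
            rw [List.append_assoc, List.cons_append] at hMj
            have := 𝕋.later_notMem_freeVars hjk hfj hMj (p := (U, .fix .nu Z Φ)) (by simp)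
            rw [hfk] at this
            exact this rfl
          · exact hWU (Prod.mk.inj hW).1
          · obtain ⟨M₅, hM₅⟩ := 𝕋.dl_prefix hjk
            have hM₃' : M₂ ++ M₃ = M₂ ++ M₄ ++ M₅ := by
              rw [hMk, hMj] at hM₅
              simpa using hM₅.symm
            have := 𝕋.later_notMem_freeVars (hkc.1.trans hcl) hfk hMk
              (hM₃' ▸ List.mem_append_left M₅ hW)
            rw [hfl] at this
            exact this rfl
        subst hWU
        exact hXU ⟨j, hj.2.1.1, hfj, (hreach hu).jump hj hnj⟩
  -- As `U` does not occur in `Φ`, only the value `ρ U ∪ X` substituted for `Z` survives: exactly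
  -- the coinduction hypothesis.
  have := ih c (hnk.trans_strict hkc) ρ' t hld.mem hsc
  rw [hc, Form.sem_subst T Φ ρ' hUb, hρ', Function.update_self,
    Function.update_comm hUZ, Form.sem_update_of_notMem T hUf, hρ] at this
  exact this

/-- Soundness at a node where a constant is introduced for a fixpoint formula. -/
theorem mem_sem_of_fix (𝕋 : PartialTableau T V N) {n c : N} {k : FixKind}
    {U Z : Var} {Φ : Form Var Act} (hfix : 𝕋.rule n = some (.fix k))
    (hfm : (𝕋.lab n).fm = .fix k Z Φ)
    (hfr : ∀ m, ¬ 𝕋.tree.StrictAnc n m → U ∉ (𝕋.lab m).vars)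
    (hp : 𝕋.tree.parent c = some n)
    (hc : 𝕋.lab c = ⟨(𝕋.lab n).st, (𝕋.lab n).dl ++ [(U, .fix k Z Φ)], .var U⟩)
    (ih : ∀ ρ t, t ∈ (𝕋.lab c).st → 𝕋.Supports ρ c t → t ∈ (𝕋.lab c).fm.sem T ρ)
    {ρ : Valuation Var St} (s : St) (hs : s ∈ (𝕋.lab n).st) (h : 𝕋.Supports ρ n s) :
    s ∈ (𝕋.lab n).fm.sem T ρ := by
  have hld : 𝕋.LocalDep c n s s := ⟨hp, by rwa [hc], hs, by simp only [hfix]⟩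
  have hUn : U ∉ (𝕋.lab n).vars := hfr n fun h => h.2 rfl
  have hUf : U ∉ (Form.fix k Z Φ).freeVars := fun hf =>
    hUn (Or.inl (Or.inl (Or.inl (hfm ▸ hf))))
  -- The new constant gets its exact value. Freshness keeps `U` out of the older definitions and out
  -- of the formulas at companion nodes above, so the other support conditions are unaffected.
  set ρ' := Function.update ρ U ((Form.fix k Z Φ).sem T ρ) with hρ'
  have hsc : 𝕋.Supports ρ' c s := by
    refine ⟨?_, ?_, ?_⟩
    · intro W hW
      rw [hc] at hW
      have hne : W ≠ U := by
        rintro rfl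
        exact hW ⟨_, List.mem_append_right _ (List.mem_singleton_self _)⟩
      rw [hρ', Function.update_of_ne hne]
      exact h.off_dom W fun ⟨Θ, hΘ⟩ => hW ⟨Θ, List.mem_append_left _ hΘ⟩
    · intro W Ψ hW
      rw [hc] at hW
      rcases List.mem_append.1 hW with hW' | hW'
      · have hne : W ≠ U := by
          rintro rfl
          exact hUn (Or.inl (Or.inr ⟨Ψ, hW'⟩))
        have hΨ : U ∉ Ψ.freeVars := fun hf => hUn (Or.inr ⟨_, hW', Or.inl hf⟩)
        rw [hρ', Function.update_of_ne hne, Form.sem_update_of_notMem T hΨ]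
        exact (h.const W Ψ hW').imp_right fun H k u hk hf hr =>
          H k u hk hf ((hr.of_child hld).mono fun _ h => h.1)
      · cases List.mem_singleton.1 hW'
        left
        rw [hρ', Form.sem_update_of_notMem T hUf, Function.update_self]
    · intro j l u hj hjc hr
      have hjn : 𝕋.tree.StrictAnc j n := by
        refine ⟨hjc.anc_parent hp, ?_⟩
        rintro rfl
        have := hj.2.1.1
        rw [IsCompanionNode, hfix] at this
        cases this
      have hUl : U ∉ (𝕋.lab l).fm.freeVars := fun hf => by
        rw [← hj.2.1.2.2.1] at hf
        exact hfr j (not_strictAnc_of_anc hjn.1) (Or.inl (Or.inl (Or.inl hf)))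
      rw [hρ', Form.sem_update_of_notMem T hUl]
      exact h.leaf j l u hj hjn ((hr.of_child hld).mono fun _ h => h.1)
  have := ih ρ' s hld.mem hsc
  rw [hc] at this
  change s ∈ ρ' U at this
  rw [hρ', Function.update_self] at this
  rwa [hfm]

/-- Soundness at the leaves of a successful tableau. -/
theorem mem_sem_of_isLeaf [Finite N] (𝕋 : PartialTableau T V N) (hsucc : 𝕋.IsSuccessful)
    {n : N} (hn : 𝕋.tree.IsLeaf n) {ρ : Valuation Var St} {s : St} (hs : s ∈ (𝕋.lab n).st)
    (h : 𝕋.Supports ρ n s) : s ∈ (𝕋.lab n).fm.sem T ρ := by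
  -- At a fixpoint leaf the leaf clause of `Supports`, with the empty path, is the claim itself; `μ`
  -- and `ν` are distinguished only at the companion node.
  have hfixleaf : ∀ k, 𝕋.IsFixLeaf k n → s ∈ (𝕋.lab n).fm.sem T ρ := by
    rintro k ⟨-, U, -, -, m, hm⟩
    obtain ⟨j, hj⟩ := 𝕋.exists_companion hn hm
    exact h.leaf j n s hj hj.2.1.2.1 .refl
  rcases hsucc.2 n hn with ⟨Z, hZ, hf, hV⟩ | ⟨Z, hZ, hf, hV⟩ | hf | ⟨hf, -⟩
  · rw [hf]
    change s ∈ ρ Z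
    rw [h.off_dom Z hZ]
    exact hV hs
  · rw [hf]
    change s ∉ ρ Z
    rw [h.off_dom Z hZ]
    exact fun hsV => Set.eq_empty_iff_forall_notMem.1 hV s ⟨hs, hsV⟩
  · exact hfixleaf _ hf
  · exact hfixleaf _ hf

theorem mem_sem_of_supports [Finite N] (𝕋 : PartialTableau T V N) (hsucc : 𝕋.IsSuccessful)
    (n : N) : ∀ (ρ : Valuation Var St) (s : St), s ∈ (𝕋.lab n).st → 𝕋.Supports ρ n s →
      s ∈ (𝕋.lab n).fm.sem T ρ := by
  induction n using 𝕋.tree.descendant_induction with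
  | h n ih =>
    intro ρ s hs h
    cases ha : 𝕋.rule n with
    | none => exact 𝕋.mem_sem_of_isLeaf hsucc ((𝕋.rule_eq_none n).1 ha) hs h
    | some a =>
      by_cases hun : a = .un
      · subst hun
        obtain ⟨U, k, Z, Φ, hfm, hU, hl⟩ := 𝕋.applies n _ ha
        obtain ⟨c, hp, hc⟩ := 𝕋.exists_child hl
        -- The fixpoint argument is needed only if the constant has its exact value; otherwise its
        -- value already contains `s`, reached by the empty path.
        rcases h.const _ _ hU with hρ | hρ
        · cases k with
          | mu =>
            exact 𝕋.mem_sem_of_mu_unfold hsucc ha hfm hU hp hc (ih c (strictAnc_of_parent hp))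
              hρ s hs h
          | nu => exact 𝕋.mem_sem_of_nu_unfold ha hfm hU ih hρ s hs h
        · rw [hfm]
          exact hρ n s ha hfm .refl
      by_cases hfix : ∃ k, a = .fix k
      · obtain ⟨k, rfl⟩ := hfix
        obtain ⟨Z, Φ, U, hfm, hfr, hl⟩ := 𝕋.applies n _ ha
        obtain ⟨c, hp, hc⟩ := 𝕋.exists_child hl
        exact 𝕋.mem_sem_of_fix ha hfm hfr hp hc (ih c (strictAnc_of_parent hp)) s hs h
      · have hnc : ¬ 𝕋.IsCompanionNode n := fun hn => by
          rw [IsCompanionNode, ha] at hn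
          exact hun (Option.some.inj hn)
        refine 𝕋.mem_sem_of_children ha hun (fun k hk => hfix ⟨k, hk⟩) hs fun c t hl => ?_
        refine ih c (strictAnc_of_parent hl.1) ρ t hl.mem (h.child hnc hl ?_)
        rcases 𝕋.child_cases hl.1 with h' | ⟨k, _, _, _, h', -⟩ | ⟨_, _, _, _, h', -⟩
        · exact h'.1
        · rw [ha] at h'
          exact absurd ⟨k, Option.some.inj h'⟩ hfix
        · exact absurd h' hnc

end PartialTableau

end TimedMu

theorem mainTheorem5 {Var : Type*} {Act : Type*} {St : Type*} {N : Type*}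
    [DecidableEq Var] [Countable Var] [Infinite Var] [Finite N]
    (T : TimedMu.TTS Act St) (V : TimedMu.Valuation Var St)
    (𝕋 : TimedMu.PartialTableau T V N) (s : TimedMu.Sequent Var Act St)
    (hfor : 𝕋.IsFor s) (hdl : s.dl = []) (hsucc : 𝕋.IsSuccessful) :
    s.Valid T V := by
  intro z hz
  subst hfor
  -- There are no constants yet, and no companion node lies strictly above the root.
  have hroot : 𝕋.Supports V 𝕋.tree.root z := by
    refine ⟨fun _ _ => rfl, fun U Ψ hU => ?_, fun j _ _ _ hj _ => ?_⟩
    · rw [hdl] at hU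
      cases hU
    · exact absurd hj (TimedMu.OrderedTree.not_strictAnc_of_anc (𝕋.tree.root_anc j))
  have := 𝕋.mem_sem_of_supports hsucc 𝕋.tree.root V z hz hroot
  rw [TimedMu.Sequent.sem, hdl]
  exact this
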